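/- A Thurston map is an orientation-preserving branched covering map $f\colon S^2\to S^2$ of degree at least $2$ whose postcritical set $\operatorname{post}(f)=\bigcup_{n\ge 1} f^n(\operatorname{crit}(f))$ is finite, where $\operatorname{crit}(f)$ is the set of points at which $f$ is not locally injective. It is called a Thurston polynomial if there is a point $p\in S^2$ with $f(p)=p$ and $f^{-1}(p)=\{p\}$. A Jordan curve $\mathcal E\subset S^2\setminus\operatorname{post}(f)$ is an equator for $f$ if (1) $\widetilde{\mathcal E}:=f^{-1}(\mathcal E)$ is connected (and hence a Jordan curve); (2) $\widetilde{\mathcal E}$ is isotopic to $\mathcal E$ rel. $\operatorname{post}(f)$, i.e. there is an isotopy $H\colon S^2\times[0,1]\to S^2$ with $H_0=\mathrm{id}$, $H_t|_{\operatorname{post}(f)}=\mathrm{id}$ for all $t$, and $H_1(\mathcal E)=\widetilde{\mathcal E}$; and (3) $H$ may be chosen so that, for an orientation of $\mathcal E$, the orientation of $\widetilde{\mathcal E}$ induced by the covering $f\colon\widetilde{\mathcal E}\to\mathcal E$ agrees with the one induced by the homeomorphism $H_1\colon\mathcal E\to\widetilde{\mathcal E}$. Proposition. Let $f\colon S^2\to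 S^2$ be a Thurston map that is not a Thurston polynomial, with $\#\operatorname{post}(f)\le 3$. Then $f$ does not have an equator. -/

import Mathlib

open scoped Topology

namespace ThurstonMap

/-- The (oriented) topological 2-sphere, modelled as the one-point compactification of `ℂ`. -/
abbrev Sphere2 : Type := OnePoint ℂ

/-- The loop `γ : ℝ → ℂ` (of period `2π`) avoids `0` and has winding number `n` around `0`:
it has a continuous logarithm that grows by `2πin` over each period. -/
def HasWindingNumber (γ : ℝ → ℂ) (n : ℤ) : Prop :=
  ∃ L : ℝ → ℂ, Continuous L ∧ (∀ t, γ t = Complex.exp (L t)) ∧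
    ∀ t, L (t + 2 * Real.pi) = L t + 2 * Real.pi * n * Complex.I

open Classical in
/-- The standard oriented local parametrization of the sphere sending `0` to `p`:
`z ↦ a + z` at a finite point `a`, and `z ↦ 1 / z` at `∞`. -/
noncomputable def stdParam : Sphere2 → ℂ → Sphere2
  | none, z => if z = 0 then OnePoint.infty else ((z⁻¹ : ℂ) : Sphere2)
  | some a, z => ((a + z : ℂ) : Sphere2)

/-- A homeomorphism `φ` from an open subset of the sphere onto an open subset of `ℂ` is
orientation-preserving: around every point `p` of its domain, small positively oriented circles
around `p` are sent to loops of winding number `1` around `φ p`. -/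
def IsOrientationPreserving (φ : OpenPartialHomeomorph Sphere2 ℂ) : Prop :=
  ∀ p ∈ φ.source, ∀ᶠ r : ℝ in 𝓝[>] 0,
    HasWindingNumber (fun t => φ (stdParam p (r * Complex.exp (t * Complex.I))) - φ p) 1

/-- An orientation-preserving branched covering map of the sphere: a continuous map that near
every point has the form `z ↦ z ^ d`, `d ≥ 1`, in orientation-preserving charts centred at the
point and at its image. (Surjectivity is automatic on the sphere.) -/
def IsBranchedCovering (f : Sphere2 → Sphere2) : Prop :=
  Continuous f ∧ ∀ p, ∃ (d : ℕ) (φ ψ : OpenPartialHomeomorph Sphere2 ℂ),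
    1 ≤ d ∧ IsOrientationPreserving φ ∧ IsOrientationPreserving ψ ∧
    p ∈ φ.source ∧ f p ∈ ψ.source ∧ φ p = 0 ∧ ψ (f p) = 0 ∧
    ∀ x ∈ φ.source, f x ∈ ψ.source ∧ ψ (f x) = φ x ^ d

/-- The degree of a branched covering map: the number of preimages of a generic point, that is,
the largest number of preimages of a point. -/
noncomputable def degree (f : Sphere2 → Sphere2) : ℕ∞ :=
  ⨆ y, (f ⁻¹' {y}).encard

/-- The critical points of `f`: the points near which `f` is not injective. -/
def criticalSet (f : Sphere2 → Sphere2) : Set Sphere2 :=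
  {c | ∀ U ∈ 𝓝 c, ¬ Set.InjOn f U}

/-- The postcritical set: the union of the forward images `f^n(crit f)`, `n ≥ 1`. -/
def postcriticalSet (f : Sphere2 → Sphere2) : Set Sphere2 :=
  ⋃ (n : ℕ) (_ : 1 ≤ n), f^[n] '' criticalSet f

/-- A Thurston map: an orientation-preserving, postcritically finite branched covering map
`S² → S²` of degree at least `2`. -/
structure IsThurstonMap (f : Sphere2 → Sphere2) : Prop where
  isBranchedCovering : IsBranchedCovering f
  two_le_degree : 2 ≤ degree f
  finite_postcriticalSet : (postcriticalSet f).Finite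

/-- A Thurston polynomial: a Thurston map with a totally invariant point. -/
def IsThurstonPolynomial (f : Sphere2 → Sphere2) : Prop :=
  IsThurstonMap f ∧ ∃ p, f p = p ∧ f ⁻¹' {p} = {p}

/-- `H` is an isotopy of the sphere rel. `P` that starts at the identity. -/
def IsIsotopyRel (H : unitInterval → Sphere2 ≃ₜ Sphere2) (P : Set Sphere2) : Prop :=
  Continuous (fun x : unitInterval × Sphere2 => H x.1 x.2) ∧
    (∀ x, H 0 x = x) ∧ ∀ t, ∀ p ∈ P, H t p = p

/-- For a Jordan curve parametrized by `γ`, the map `g` sends the curve to itself and is an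
orientation-preserving covering of it: read on the circle through `γ`, it lifts to a
strictly increasing continuous map of `ℝ`. (In particular this does not depend on the
orientation chosen on the curve.) -/
def PreservesCurveOrientation (γ : Circle → Sphere2) (g : Sphere2 → Sphere2) : Prop :=
  ∃ θ : ℝ → ℝ, Continuous θ ∧ StrictMono θ ∧
    ∀ t, g (γ (Circle.exp t)) = γ (Circle.exp (θ t))

/-- The set `E` is an equator for `f`: it is a Jordan curve (parametrized by `γ`) in the complement
of the postcritical set, its preimage `f⁻¹(E)` is connected, and some isotopy `H` rel. the
postcritical set deforms `E` to `f⁻¹(E)` in such a way that the orientations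
induced on `f⁻¹(E)` by `f : f⁻¹(E) → E` and by `H₁ : E → f⁻¹(E)` agree, i.e. such that
`f ∘ H₁ : E → E` preserves orientation. -/
def IsEquator (f : Sphere2 → Sphere2) (E : Set Sphere2) : Prop :=
  ∃ γ : Circle → Sphere2, Continuous γ ∧ Function.Injective γ ∧ Set.range γ = E ∧
    Disjoint E (postcriticalSet f) ∧ IsConnected (f ⁻¹' E) ∧
    ∃ H : unitInterval → Sphere2 ≃ₜ Sphere2, IsIsotopyRel H (postcriticalSet f) ∧
      H 1 '' E = f ⁻¹' E ∧ PreservesCurveOrientation γ (fun x => f (H 1 x))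

/-- `f` has an equator. -/
def HasEquator (f : Sphere2 → Sphere2) : Prop :=
  ∃ E, IsEquator f E

end ThurstonMap

/-! Let `γ` parametrize an equator and put `δ = H 1 ∘ γ`, a parametrization of its preimage. With at
most three postcritical points, one side `U` of `γ` contains at most one of them. If `p` is the only
postcritical point in `U`, then `f` is a covering over `U` minus `p`. This covering is connected,
because each of its components reaches the single curve `δ`. A connected covering of a punctured
disc has one end, so `p` has one preimage (`IsBranchedCovering.subsingleton_fiber`). If a side had
no postcritical point, the same argument at each of its points would force degree one
(`IsThurstonMap.not_forall_subsingleton`).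

So there are postcritical points `p ∈ U` and `q` on the other side. The isotopy fixes both, hence
`δ` winds around the pair `(p, q)` as `γ` does. Let `x` be the preimage of `p`. Were `x` on the side
of `δ` opposite to `p`, the positive local degree of `f` at `x` would make `δ → γ` reverse
orientation (`IsBranchedCovering.mem_side`). So `x` and `p` share a side of `δ`, which `f` maps into
`U`. Then `f p` is postcritical and lies in `U`, so `f p = p`, and `f` is a Thurston polynomial
(`IsThurstonMap.isThurstonPolynomial`).

Everything is expressed by continuous logarithms and the winding numbers `index γ u v`, including
the Jordan curve theorem (`exists_areSides`). The role of the Schoenflies theorem is played by a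
retraction of the universal covering of the twice punctured sphere onto a closed side
(`AreSides.exists_retracted_expCover`): its domain is `ℂ`, so lifts and logarithms exist there. -/

namespace ThurstonMap

open Complex Filter

/-! ### Continuous logarithms and winding numbers. -/

/-- Two continuous logarithms of the same function on a preconnected set differ by a constant
integral multiple of `2πi`. -/
theorem exists_int_of_exp_eq {X : Type*} [TopologicalSpace X] {s : Set X} (hs : IsPreconnected s)
    {A B : X → ℂ} (hA : ContinuousOn A s) (hB : ContinuousOn B s)
    (h : ∀ x ∈ s, exp (A x) = exp (B x)) :
    ∃ n : ℤ, ∀ x ∈ s, A x = B x + 2 * Real.pi * n * I := by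
  rcases s.eq_empty_or_nonempty with rfl | ⟨x₀, hx₀⟩
  · exact ⟨0, by simp⟩
  have hc : ∀ x ∈ s, A x - B x = A x₀ - B x₀ := fun x hx =>
    isCoveringMap_exp.constOn_of_comp hs (hA.sub hB)
      (fun a ha b hb => by simp [Complex.exp_sub, h a ha, h b hb]) hx hx₀
  obtain ⟨n, hn⟩ := exp_eq_exp_iff_exists_int.1 (h x₀ hx₀)
  refine ⟨n, fun x hx => ?_⟩
  have := hc x hx
  rw [hn] at this
  linear_combination this

/-- A homotopy of nonvanishing functions that starts at `1` has a continuous logarithm. -/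
theorem exists_log_homotopy {X : Type*} [TopologicalSpace X] {F : unitInterval × X → ℂ} (hF : Continuous F)
    (h0 : ∀ x, F x ≠ 0) (h1 : ∀ x, F (0, x) = 1) :
    ∃ L : unitInterval × X → ℂ, Continuous L ∧ (∀ x, F x = exp (L x)) ∧ ∀ x, L (0, x) = 0 := by
  let H : C(unitInterval × X, {z : ℂ // z ≠ 0}) := ⟨fun x => ⟨F x, h0 x⟩, by fun_prop⟩
  have H0 : ∀ a, H (0, a) = (fun z : ℂ => (⟨_, z.exp_ne_zero⟩ : {z : ℂ // z ≠ 0}))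
      ((0 : C(X, ℂ)) a) := fun a => Subtype.ext (by simp [H, h1])
  refine ⟨isCoveringMap_exp.liftHomotopy H 0 H0, (isCoveringMap_exp.liftHomotopy H 0 H0).continuous,
    fun x => ?_, fun x => isCoveringMap_exp.liftHomotopy_zero H 0 H0 x⟩
  have := congrFun (isCoveringMap_exp.liftHomotopy_lifts H 0 H0) x
  exact (congrArg Subtype.val this).symm

/-- A nonvanishing continuous function on a convex set has a continuous logarithm. -/
theorem exists_log_of_convex {E : Type*} [NormedAddCommGroup E] [NormedSpace ℝ E] {s : Set E}
    (hs : Convex ℝ s) {h : E → ℂ} (hh : ContinuousOn h s) (h0 : ∀ x ∈ s, h x ≠ 0) :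
    ∃ L : E → ℂ, ContinuousOn L s ∧ ∀ x ∈ s, h x = exp (L x) := by
  classical
  rcases s.eq_empty_or_nonempty with rfl | ⟨x₀, hx₀⟩
  · exact ⟨0, by simp, by simp⟩
  have hmem : ∀ y : unitInterval × s, x₀ + (y.1 : ℝ) • ((y.2 : E) - x₀) ∈ s := fun y =>
    hs.add_smul_sub_mem hx₀ y.2.2 y.1.2
  -- Contracting `s` radially to `x₀` makes `h / h x₀` the end of a homotopy that starts at `1`.
  let F : unitInterval × s → ℂ := fun y => h (x₀ + (y.1 : ℝ) • ((y.2 : E) - x₀)) / h x₀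
  have hF : Continuous F :=
    (hh.comp_continuous (by fun_prop) hmem).div_const _
  obtain ⟨L, hL, hFL, -⟩ := exists_log_homotopy hF
    (fun y => div_ne_zero (h0 _ (hmem y)) (h0 _ hx₀)) (fun y => by simp [F, h0 _ hx₀])
  refine ⟨fun x => if hx : x ∈ s then L (1, ⟨x, hx⟩) + log (h x₀) else 0, ?_, fun x hx => ?_⟩
  · rw [continuousOn_iff_continuous_domRestrict]
    have : Continuous fun x : s => L (1, x) + log (h x₀) := by fun_prop
    convert this using 2 with x
    simp
  · have := hFL (1, ⟨x, hx⟩)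
    simp only [F, Set.Icc.coe_one, one_smul, add_sub_cancel] at this
    dsimp only
    rw [dif_pos hx, Complex.exp_add, ← this, exp_log (h0 _ hx₀), div_mul_cancel₀ _ (h0 _ hx₀)]

theorem exists_log {E : Type*} [NormedAddCommGroup E] [NormedSpace ℝ E] {h : E → ℂ}
    (hh : Continuous h) (h0 : ∀ x, h x ≠ 0) :
    ∃ L : E → ℂ, Continuous L ∧ ∀ x, h x = exp (L x) := by
  obtain ⟨L, hL, h1⟩ := exists_log_of_convex convex_univ hh.continuousOn (fun x _ => h0 x)
  exact ⟨L, continuousOn_univ.1 hL, fun x => h1 x trivial⟩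

theorem exists_int_of_exp_eq' {X : Type*} [TopologicalSpace X] [PreconnectedSpace X]
    {A B : X → ℂ} (hA : Continuous A) (hB : Continuous B) (h : ∀ x, exp (A x) = exp (B x)) :
    ∃ n : ℤ, ∀ x, A x = B x + 2 * Real.pi * n * I := by
  obtain ⟨n, hn⟩ := exists_int_of_exp_eq isPreconnected_univ hA.continuousOn hB.continuousOn
    (fun x _ => h x)
  exact ⟨n, fun x => hn x trivial⟩

theorem two_pi_mul_I_injective {m n : ℤ} (h : (2 * Real.pi * m * I : ℂ) = 2 * Real.pi * n * I) :
    m = n := by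
  have h1 : (2 * Real.pi : ℂ) ≠ 0 := by exact_mod_cast Real.two_pi_pos.ne'
  have h2 := mul_left_cancel₀ h1 (mul_right_cancel₀ I_ne_zero h)
  exact_mod_cast h2

/-- A continuous logarithm of a loop grows by an integral multiple of `2πi` over each period. -/
theorem HasWindingNumber.exists_of_log {γ : ℝ → ℂ} (hp : ∀ t, γ (t + 2 * Real.pi) = γ t)
    {L : ℝ → ℂ} (hL : Continuous L) (h : ∀ t, γ t = exp (L t)) :
    ∃ n : ℤ, ∀ t, L (t + 2 * Real.pi) = L t + 2 * Real.pi * n * I :=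
  exists_int_of_exp_eq' (A := fun t => L (t + 2 * Real.pi)) (by fun_prop) hL
    fun t => by rw [← h, ← h, hp]

theorem exists_hasWindingNumber {γ : ℝ → ℂ} (hγ : Continuous γ) (h0 : ∀ t, γ t ≠ 0)
    (hp : ∀ t, γ (t + 2 * Real.pi) = γ t) : ∃ n, HasWindingNumber γ n := by
  obtain ⟨L, hL, h⟩ := exists_log hγ h0
  obtain ⟨n, hn⟩ := HasWindingNumber.exists_of_log hp hL h
  exact ⟨n, L, hL, h, hn⟩

/-- Every continuous logarithm of a loop has the increment given by the winding number. -/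
theorem HasWindingNumber.log_increment {γ : ℝ → ℂ} {n : ℤ} (h : HasWindingNumber γ n)
    {L : ℝ → ℂ} (hL : Continuous L) (hγ : ∀ t, γ t = exp (L t)) (t : ℝ) :
    L (t + 2 * Real.pi) = L t + 2 * Real.pi * n * I := by
  obtain ⟨M, hM, hγM, hn⟩ := h
  obtain ⟨k, hk⟩ := exists_int_of_exp_eq' hL hM fun t => by rw [← hγ, ← hγM]
  rw [hk, hk, hn]; ring

theorem HasWindingNumber.unique {γ : ℝ → ℂ} {m n : ℤ} (hm : HasWindingNumber γ m)
    (hn : HasWindingNumber γ n) : m = n := by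
  obtain ⟨L, hL, h, hi⟩ := hm
  have h1 := hn.log_increment hL h 0
  rw [hi 0] at h1
  exact two_pi_mul_I_injective (add_left_cancel h1)

theorem HasWindingNumber.mul {γ δ : ℝ → ℂ} {m n : ℤ} (hm : HasWindingNumber γ m)
    (hn : HasWindingNumber δ n) : HasWindingNumber (fun t => γ t * δ t) (m + n) := by
  obtain ⟨L, hL, h, hi⟩ := hm
  obtain ⟨M, hM, h', hi'⟩ := hn
  refine ⟨fun t => L t + M t, hL.add hM, fun t => by simp only [Complex.exp_add, h, h'], fun t => ?_⟩
  simp only [hi, hi']; push_cast; ring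

theorem HasWindingNumber.zpow {γ : ℝ → ℂ} {m : ℤ} (hm : HasWindingNumber γ m) (k : ℤ) :
    HasWindingNumber (fun t => γ t ^ k) (k * m) := by
  obtain ⟨L, hL, h, hi⟩ := hm
  refine ⟨fun t => k * L t, continuous_const.mul hL, fun t => by simp only [exp_int_mul, h], fun t => ?_⟩
  simp only [hi]; push_cast; ring

theorem hasWindingNumber_const {c : ℂ} (hc : c ≠ 0) : HasWindingNumber (fun _ => c) 0 :=
  ⟨fun _ => log c, continuous_const, fun _ => (exp_log hc).symm, by simp⟩

theorem hasWindingNumber_exp : HasWindingNumber (fun t => exp (t * I)) 1 :=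
  ⟨fun t => t * I, by fun_prop, fun _ => rfl, fun t => by push_cast; ring⟩

/-- The winding number is invariant under homotopies of loops in the punctured plane. -/
theorem HasWindingNumber.homotopy {F : unitInterval → ℝ → ℂ} (hF : Continuous fun x : unitInterval × ℝ => F x.1 x.2)
    (h0 : ∀ τ t, F τ t ≠ 0) (hp : ∀ τ t, F τ (t + 2 * Real.pi) = F τ t) {n : ℤ}
    (h : HasWindingNumber (F 0) n) : HasWindingNumber (F 1) n := by
  obtain ⟨L, hL, hFL, hi⟩ := h
  have hF0 : Continuous fun x : unitInterval × ℝ => F 0 x.2 := by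
    exact hF.comp (f := fun x : unitInterval × ℝ => ((0 : unitInterval), x.2)) (by fun_prop)
  obtain ⟨M, hM, hFM, hM0⟩ := exists_log_homotopy (F := fun x : unitInterval × ℝ => F x.1 x.2 / F 0 x.2)
    (hF.div hF0 fun x => h0 _ _) (fun x => div_ne_zero (h0 _ _) (h0 _ _))
    (fun x => div_self (h0 _ _))
  have hexp : ∀ τ t, F τ t = exp (M (τ, t) + L t) := fun τ t => by
    rw [Complex.exp_add, ← hFM, ← hFL]; exact (div_mul_cancel₀ _ (h0 _ _)).symm
  obtain ⟨k, hk⟩ := exists_int_of_exp_eq'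
    (A := fun x : unitInterval × ℝ => M (x.1, x.2 + 2 * Real.pi) + L (x.2 + 2 * Real.pi))
    (B := fun x : unitInterval × ℝ => M x + L x.2) (by fun_prop) (by fun_prop)
    (fun x => by rw [← hexp, ← hexp, hp])
  -- The increment `k` is the same for all times; at time `0` the term `M` vanishes and only that of
  -- `L` remains.
  have hkn : k = n := by
    have h1 := hk (0, 0)
    simp only [hM0, hi] at h1
    exact two_pi_mul_I_injective (by linear_combination -h1)
  subst hkn
  exact ⟨fun t => M (1, t) + L t, by fun_prop, hexp 1, fun t => hk (1, t)⟩

/-! ### Möbius coordinates and the universal covering of the twice punctured sphere. -/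

/-- Homogeneous coordinates on the sphere: numerator. -/
noncomputable def num (z : Sphere2) : ℂ := z.elim 1 id

/-- Homogeneous coordinates on the sphere: denominator. -/
noncomputable def den (z : Sphere2) : ℂ := z.elim 0 fun _ => 1

@[simp] theorem num_infty : num OnePoint.infty = 1 := rfl
@[simp] theorem den_infty : den OnePoint.infty = 0 := rfl
@[simp] theorem num_coe (a : ℂ) : num (a : Sphere2) = a := rfl
@[simp] theorem den_coe (a : ℂ) : den (a : Sphere2) = 1 := rfl

/-- The determinant of the homogeneous coordinates of two points. -/
noncomputable def bracket (z u : Sphere2) : ℂ := num z * den u - den z * num u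

theorem bracket_eq_zero_iff {z u : Sphere2} : bracket z u = 0 ↔ z = u := by
  induction z using OnePoint.rec <;> induction u using OnePoint.rec <;>
    simp [bracket, sub_eq_zero]

theorem bracket_ne_zero {z u : Sphere2} (h : z ≠ u) : bracket z u ≠ 0 :=
  mt bracket_eq_zero_iff.1 h

theorem bracket_self (z : Sphere2) : bracket z z = 0 := bracket_eq_zero_iff.2 rfl

/-- The Möbius coordinate with its zero at `u` and its pole at `v`. -/
noncomputable def mobius (u v z : Sphere2) : ℂ := bracket z u / bracket z v

theorem mobius_self (u v : Sphere2) : mobius u v u = 0 := by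
  simp [mobius, bracket_self]

theorem mobius_ne_zero {u v z : Sphere2} (hu : z ≠ u) (hv : z ≠ v) : mobius u v z ≠ 0 :=
  div_ne_zero (bracket_ne_zero hu) (bracket_ne_zero hv)

/-- This cocycle rule is the source of the additivity of the index. -/
theorem mobius_mul {u v y z : Sphere2} (hv : z ≠ v) :
    mobius u v z * mobius v y z = mobius u y z :=
  div_mul_div_cancel₀ (bracket_ne_zero hv)

theorem mobius_inv (u v z : Sphere2) : (mobius u v z)⁻¹ = mobius v u z := by
  simp [mobius]

/-- The cross-ratio identity. -/
theorem mobius_eq_mul {u v z e : Sphere2} (hu : e ≠ u) (hv : e ≠ v) (hz : z ≠ v) :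
    mobius u v z = mobius u v e * (1 - mobius e v z * mobius v e u) := by
  have h1 := bracket_ne_zero hv
  have h2 := bracket_ne_zero hz
  have h3 := bracket_ne_zero hu.symm
  unfold mobius
  field_simp
  unfold bracket
  ring

theorem continuousAt_mobius {u v z : Sphere2} (h : z ≠ v) : ContinuousAt (mobius u v) z := by
  induction z using OnePoint.rec with
  | infty =>
    induction v using OnePoint.rec with
    | infty => exact absurd rfl h
    | coe b =>
    rw [OnePoint.continuousAt_infty', coclosedCompact_eq_cocompact]
    have hb : Tendsto (fun z : ℂ => (z - b)⁻¹) (cocompact ℂ) (𝓝 0) := by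
      have h1 : Tendsto (fun z : ℂ => z - b) (cocompact ℂ) (cocompact ℂ) :=
        (Homeomorph.subRight b).isClosedEmbedding.tendsto_cocompact
      rw [← Metric.cobounded_eq_cocompact] at h1 ⊢
      exact tendsto_inv₀_cobounded.comp h1
    have hne : ∀ᶠ z : ℂ in cocompact ℂ, z ≠ b := by
      rw [← Metric.cobounded_eq_cocompact]
      exact Bornology.eventually_ne_cobounded b
    induction u using OnePoint.rec with
    | infty =>
      have := hb.neg
      simp only [neg_zero] at this
      refine (this.congr fun z => ?_).trans (by simp [mobius, bracket])
      simp [mobius, bracket, neg_div]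
    | coe a =>
      have := (hb.const_mul (b - a)).const_add 1
      simp only [mul_zero, add_zero] at this
      refine (this.congr' (hne.mono fun z hz => ?_)).trans (by simp [mobius, bracket])
      have : z - b ≠ 0 := sub_ne_zero.2 hz
      simp [mobius, bracket]
      field_simp
      ring
  | coe c =>
    rw [OnePoint.continuousAt_coe]
    have h1 : (fun z : ℂ => mobius u v z) =
        fun z : ℂ => (z * den u - num u) / (z * den v - num v) := by
      funext z; simp [mobius, bracket]
    have h2 : c * den v - num v ≠ 0 := by
      have := bracket_ne_zero h
      simpa [bracket] using this
    change ContinuousAt (fun z : ℂ => mobius u v z) c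
    rw [h1]
    exact ContinuousAt.div (by fun_prop) (by fun_prop) h2

/-- The point of the sphere with given homogeneous coordinates. -/
noncomputable def ofHom (a b : ℂ) : Sphere2 :=
  open Classical in if b = 0 then OnePoint.infty else ((a / b : ℂ) : Sphere2)

theorem ofHom_mul_num_den {c : ℂ} (hc : c ≠ 0) (z : Sphere2) :
    ofHom (c * num z) (c * den z) = z := by
  induction z using OnePoint.rec <;> simp [ofHom, hc]

theorem bracket_ofHom {a b : ℂ} (h : a ≠ 0 ∨ b ≠ 0) :
    ∃ c : ℂ, c ≠ 0 ∧ ∀ u, bracket (ofHom a b) u = c * (a * den u - b * num u) := by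
  by_cases hb : b = 0
  · have ha : a ≠ 0 := by tauto
    exact ⟨a⁻¹, inv_ne_zero ha, fun u => by simp [ofHom, hb, bracket, ha]⟩
  · refine ⟨b⁻¹, inv_ne_zero hb, fun u => ?_⟩
    simp only [ofHom, hb, if_false, bracket, num_coe, den_coe]
    field_simp

theorem continuousAt_ofHom {a b : ℂ} (h : a ≠ 0 ∨ b ≠ 0) :
    ContinuousAt (fun x : ℂ × ℂ => ofHom x.1 x.2) (a, b) := by
  by_cases hb : b = 0
  · have ha : a ≠ 0 := by tauto
    subst hb
    unfold ContinuousAt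
    have h0 : ofHom a 0 = OnePoint.infty := by simp [ofHom]
    simp only [h0]
    -- On the line `x.2 = 0` the map is constantly `∞`; off it, the quotient has norm tending to
    -- infinity.
    have hsplit : 𝓝 ((a, 0) : ℂ × ℂ) =
        𝓝[{x | x.2 = 0}] (a, 0) ⊔ 𝓝[{x | x.2 = 0}ᶜ] (a, 0) := by
      rw [← nhdsWithin_union, Set.union_compl_self, nhdsWithin_univ]
    rw [hsplit]
    refine Tendsto.sup ?_ ?_
    · refine tendsto_const_nhds.congr' ?_
      filter_upwards [self_mem_nhdsWithin] with x hx
      have : x.2 = 0 := hx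
      simp [ofHom, this]
    · have h1 : Tendsto (fun x : ℂ × ℂ => x.1 / x.2) (𝓝[{x | x.2 = 0}ᶜ] (a, 0))
          (coclosedCompact ℂ) := by
        rw [coclosedCompact_eq_cocompact, ← Metric.cobounded_eq_cocompact,
          ← tendsto_norm_atTop_iff_cobounded]
        have h2 : Tendsto (fun x : ℂ × ℂ => ‖x.1‖) (𝓝[{x | x.2 = 0}ᶜ] (a, 0)) (𝓝 ‖a‖) :=
          (continuous_fst.norm.tendsto (a, (0 : ℂ))).mono_left nhdsWithin_le_nhds
        have h3 : Tendsto (fun x : ℂ × ℂ => ‖x.2⁻¹‖) (𝓝[{x | x.2 = 0}ᶜ] (a, 0)) atTop := by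
          rw [tendsto_norm_atTop_iff_cobounded]
          refine tendsto_inv₀_nhdsNE_zero.comp ?_
          refine tendsto_nhdsWithin_of_tendsto_nhds_of_eventually_within _
            ((continuous_snd.tendsto (a, (0 : ℂ))).mono_left nhdsWithin_le_nhds) ?_
          exact self_mem_nhdsWithin
        refine (h2.pos_mul_atTop (norm_pos_iff.2 ha) h3).congr fun x => ?_
        rw [← norm_mul, div_eq_mul_inv]
      refine (OnePoint.tendsto_coe_infty.comp h1).congr' ?_
      filter_upwards [self_mem_nhdsWithin] with x hx
      have : x.2 ≠ 0 := hx
      simp [ofHom, this]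
  · have h1 : ContinuousAt (fun x : ℂ × ℂ => ((x.1 / x.2 : ℂ) : Sphere2)) (a, b) :=
      OnePoint.continuous_coe.continuousAt.comp (continuousAt_fst.div continuousAt_snd hb)
    refine h1.congr ?_
    filter_upwards [continuousAt_snd.eventually_ne hb] with x hx
    simp [ofHom, hx]

/-- The inverse of the Möbius coordinate `mobius u v`. -/
noncomputable def mobiusInv (u v : Sphere2) (ζ : ℂ) : Sphere2 :=
  ofHom (num u - ζ * num v) (den u - ζ * den v)

theorem mobiusInv_coords_ne_zero {u v : Sphere2} (h : u ≠ v) (ζ : ℂ) :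
    num u - ζ * num v ≠ 0 ∨ den u - ζ * den v ≠ 0 := by
  by_contra! hc
  apply bracket_ne_zero h
  unfold bracket
  linear_combination den v * hc.1 - num v * hc.2

theorem bracket_mobiusInv {u v : Sphere2} (h : u ≠ v) (ζ : ℂ) :
    ∃ c : ℂ, c ≠ 0 ∧ bracket (mobiusInv u v ζ) u = c * ζ * bracket u v ∧
      bracket (mobiusInv u v ζ) v = c * bracket u v := by
  obtain ⟨c, hc, hb⟩ := bracket_ofHom (mobiusInv_coords_ne_zero h ζ)
  refine ⟨c, hc, ?_, ?_⟩ <;> unfold mobiusInv <;> rw [hb] <;> unfold bracket <;> ring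

theorem mobiusInv_ne {u v : Sphere2} (h : u ≠ v) (ζ : ℂ) : mobiusInv u v ζ ≠ v := by
  obtain ⟨c, hc, -, h2⟩ := bracket_mobiusInv h ζ
  intro he
  rw [he, bracket_self] at h2
  exact mul_ne_zero hc (bracket_ne_zero h) h2.symm

theorem mobius_mobiusInv {u v : Sphere2} (h : u ≠ v) (ζ : ℂ) :
    mobius u v (mobiusInv u v ζ) = ζ := by
  obtain ⟨c, hc, h1, h2⟩ := bracket_mobiusInv h ζ
  have := bracket_ne_zero h
  unfold mobius
  rw [h1, h2]
  field_simp

theorem mobiusInv_mobius {u v z : Sphere2} (h : u ≠ v) (hz : z ≠ v) :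
    mobiusInv u v (mobius u v z) = z := by
  have h1 := bracket_ne_zero h
  have h2 := bracket_ne_zero hz
  unfold mobiusInv
  convert ofHom_mul_num_den (div_ne_zero h1 h2) z using 2
  · unfold mobius; field_simp; unfold bracket; ring
  · unfold mobius; field_simp; unfold bracket; ring

theorem mobiusInv_zero (u v : Sphere2) : mobiusInv u v 0 = u := by
  simpa [mobiusInv] using ofHom_mul_num_den one_ne_zero u

theorem continuous_mobiusInv {u v : Sphere2} (h : u ≠ v) : Continuous (mobiusInv u v) := by
  rw [continuous_iff_continuousAt]
  intro ζ
  exact (continuousAt_ofHom (mobiusInv_coords_ne_zero h ζ)).comp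
    (f := fun ζ : ℂ => (num u - ζ * num v, den u - ζ * den v)) (by fun_prop)

/-- The universal covering of the sphere punctured at `u` and `v`. -/
noncomputable def expCover (u v : Sphere2) (s : ℂ) : Sphere2 := mobiusInv u v (exp s)

theorem continuous_expCover {u v : Sphere2} (h : u ≠ v) : Continuous (expCover u v) :=
  (continuous_mobiusInv h).comp continuous_exp

theorem mobius_expCover {u v : Sphere2} (h : u ≠ v) (s : ℂ) :
    mobius u v (expCover u v s) = exp s := mobius_mobiusInv h _

theorem expCover_ne_right {u v : Sphere2} (h : u ≠ v) (s : ℂ) : expCover u v s ≠ v :=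
  mobiusInv_ne h _

theorem expCover_ne_left {u v : Sphere2} (h : u ≠ v) (s : ℂ) : expCover u v s ≠ u := by
  intro he
  have := mobius_expCover h s
  rw [he, mobius_self] at this
  exact exp_ne_zero s this.symm

theorem expCover_eq_of_mobius {u v z : Sphere2} (h : u ≠ v) (hz : z ≠ v) {s : ℂ}
    (hs : mobius u v z = exp s) : expCover u v s = z := by
  rw [expCover, ← hs, mobiusInv_mobius h hz]

theorem expCover_add_int {u v : Sphere2} (s : ℂ) (n : ℤ) :
    expCover u v (s + 2 * Real.pi * n * I) = expCover u v s := by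
  unfold expCover
  congr 1
  rw [exp_eq_exp_iff_exists_int]
  exact ⟨n, by ring⟩

/-- Far to the left, the universal covering is close to the first puncture. -/
theorem exists_expCover_mem {u v : Sphere2} (h : u ≠ v) {N : Set Sphere2} (hN : N ∈ 𝓝 u) :
    ∃ M : ℝ, ∀ s : ℂ, s.re < M → expCover u v s ∈ N := by
  have h1 : mobiusInv u v ⁻¹' N ∈ 𝓝 (0 : ℂ) := by
    apply (continuous_mobiusInv h).continuousAt
    rwa [mobiusInv_zero]
  obtain ⟨r, hr, hsub⟩ := Metric.mem_nhds_iff.1 h1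
  refine ⟨Real.log r, fun s hs => hsub ?_⟩
  rw [mem_ball_zero_iff, norm_exp]
  rwa [Real.lt_log_iff_exp_lt hr] at hs

theorem expCover_neg {u v : Sphere2} (h : u ≠ v) (s : ℂ) :
    expCover u v (-s) = expCover v u s := by
  refine expCover_eq_of_mobius h (expCover_ne_left h.symm s) ?_
  rw [← mobius_inv, mobius_expCover h.symm, Complex.exp_neg]

/-! ### The index of a closed curve relative to two points. -/

theorem hasWindingNumber_zero_of_norm_sub_one_lt {c : ℝ → ℂ} (hc : Continuous c)
    (hp : ∀ t, c (t + 2 * Real.pi) = c t) (h : ∀ t, ‖c t - 1‖ < 1) : HasWindingNumber c 0 := by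
  have hs : ∀ t, c t ∈ slitPlane := fun t => by
    have := mem_slitPlane_of_norm_lt_one (h t)
    simpa using this
  exact ⟨fun t => log (c t), hc.clog hs, fun t => (exp_log (slitPlane_ne_zero (hs t))).symm,
    fun t => by simp [hp]⟩

/-- The winding number of the closed curve `γ` relative to the ordered pair of points `u`, `v`:
the winding number around `0` of its image under a Möbius map sending `u` to `0`, `v` to `∞`. -/
noncomputable def index (γ : Circle → Sphere2) (u v : Sphere2) : ℤ :=
  open Classical in
  if h : ∃ n, HasWindingNumber (fun t => mobius u v (γ (Circle.exp t))) n then h.choose else 0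

theorem index_eq {γ : Circle → Sphere2} {u v : Sphere2} {n : ℤ}
    (h : HasWindingNumber (fun t => mobius u v (γ (Circle.exp t))) n) : index γ u v = n := by
  have h' : ∃ n, HasWindingNumber (fun t => mobius u v (γ (Circle.exp t))) n := ⟨n, h⟩
  rw [index, dif_pos h']
  exact h'.choose_spec.unique h

section Index

variable {γ : Circle → Sphere2}

theorem ne_of_notMem_range {u : Sphere2} (hu : u ∉ Set.range γ) (z : Circle) : γ z ≠ u :=
  fun h => hu ⟨z, h⟩

theorem continuous_mobius_comp (hγ : Continuous γ) (u : Sphere2) {v : Sphere2}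
    (hv : v ∉ Set.range γ) : Continuous fun z => mobius u v (γ z) :=
  continuous_iff_continuousAt.2 fun z =>
    (continuousAt_mobius (ne_of_notMem_range hv z)).comp hγ.continuousAt

theorem hasWindingNumber_index (hγ : Continuous γ) {u v : Sphere2} (hu : u ∉ Set.range γ)
    (hv : v ∉ Set.range γ) :
    HasWindingNumber (fun t => mobius u v (γ (Circle.exp t))) (index γ u v) := by
  obtain ⟨n, hn⟩ := exists_hasWindingNumber
    ((continuous_mobius_comp hγ u hv).comp Circle.exp.continuous)
    (fun t => mobius_ne_zero (ne_of_notMem_range hu _) (ne_of_notMem_range hv _))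
    (fun t => by simp [Circle.exp_add])
  rw [index_eq hn]
  exact hn

theorem index_add (hγ : Continuous γ) {u v y : Sphere2} (hu : u ∉ Set.range γ)
    (hv : v ∉ Set.range γ) (hy : y ∉ Set.range γ) :
    index γ u v + index γ v y = index γ u y := by
  refine (index_eq ?_).symm
  have := (hasWindingNumber_index hγ hu hv).mul (hasWindingNumber_index hγ hv hy)
  simpa only [mobius_mul (ne_of_notMem_range hv _)] using this

theorem index_self (hγ : Continuous γ) {u : Sphere2} (hu : u ∉ Set.range γ) : index γ u u = 0 := by
  have := index_add hγ hu hu hu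
  omega

theorem index_neg (hγ : Continuous γ) {u v : Sphere2} (hu : u ∉ Set.range γ)
    (hv : v ∉ Set.range γ) : index γ u v = -index γ v u := by
  have h1 := index_add hγ hu hv hu
  rw [index_self hγ hu] at h1
  omega

/-- By the cross-ratio identity based at `γ 1`, the coordinate `mobius u v` along the curve is a
constant times `1 - ε`, where `ε` is uniformly small when `u` is near `v`. -/
theorem eventually_index_eq_zero (hγ : Continuous γ) {v : Sphere2} (hv : v ∉ Set.range γ) :
    ∀ᶠ u in 𝓝 v, index γ u v = 0 := by
  have hE : IsClosed (Set.range γ) := (isCompact_range hγ).isClosed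
  have hev := ne_of_notMem_range hv 1
  obtain ⟨C, hC⟩ := isCompact_univ.exists_bound_of_continuousOn
    (continuous_mobius_comp hγ (γ 1) hv).continuousOn
  have h0 : Tendsto (fun u => C * ‖mobius v (γ 1) u‖) (𝓝 v) (𝓝 0) := by
    have := (continuousAt_mobius (u := v) hev.symm).norm.tendsto.const_mul C
    simpa [mobius_self] using this
  filter_upwards [h0.eventually (gt_mem_nhds one_pos), hE.isOpen_compl.mem_nhds hv] with u hu hu'
  have heu := ne_of_notMem_range hu' 1
  have h1 : HasWindingNumber (fun t : ℝ =>
      1 - mobius (γ 1) v (γ (Circle.exp t)) * mobius v (γ 1) u) 0 := by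
    refine hasWindingNumber_zero_of_norm_sub_one_lt ?_ (fun t => by simp [Circle.exp_add])
      fun t => ?_
    · exact continuous_const.sub
        (((continuous_mobius_comp hγ _ hv).comp Circle.exp.continuous).mul continuous_const)
    · rw [sub_sub_cancel_left, norm_neg, norm_mul]
      exact (mul_le_mul_of_nonneg_right (hC _ trivial) (norm_nonneg _)).trans_lt hu
  apply index_eq
  have h2 := (hasWindingNumber_const (mobius_ne_zero heu hev)).mul h1
  simpa only [← mobius_eq_mul heu hev (ne_of_notMem_range hv _), add_zero] using h2

theorem isOpen_index_eq (hγ : Continuous γ) {v : Sphere2} (hv : v ∉ Set.range γ) (n : ℤ) :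
    IsOpen {u | u ∉ Set.range γ ∧ index γ u v = n} := by
  have hE : IsClosed (Set.range γ) := (isCompact_range hγ).isClosed
  rw [isOpen_iff_mem_nhds]
  rintro u ⟨hu, rfl⟩
  filter_upwards [eventually_index_eq_zero hγ hu, hE.isOpen_compl.mem_nhds hu] with w hw hw'
  refine ⟨hw', ?_⟩
  rw [← index_add hγ hw' hu hv, hw, zero_add]

/-- A function on the circle of winding number zero has a logarithm that extends, along a Jordan
curve, to the whole sphere. -/
theorem exists_log_extension (hγ : Continuous γ) (hi : Function.Injective γ) {c : Circle → ℂ}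
    (hc : HasWindingNumber (fun t => c (Circle.exp t)) 0) :
    ∃ ℓ : Sphere2 → ℂ, Continuous ℓ ∧ ∀ z, c z = exp (ℓ (γ z)) := by
  obtain ⟨L, hL, hcL, hp⟩ := hc
  have hper : Function.Periodic L (2 * Real.pi) := fun t => by simpa using hp t
  have hq : Topology.IsQuotientMap Circle.exp :=
    Circle.isCoveringMap_exp.isQuotientMap Circle.exp_surjective
  have hlift : ∀ a b, Circle.exp a = Circle.exp b → L a = L b := fun a b hab => by
    obtain ⟨m, rfl⟩ := Circle.exp_eq_exp.1 hab
    exact hper.int_mul m b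
  let ℓ : C(Circle, ℂ) := hq.lift (f := Circle.exp) ⟨L, hL⟩ hlift
  have hℓ : ∀ t, ℓ (Circle.exp t) = L t := fun t =>
    congrArg (fun g : C(ℝ, ℂ) => g t) (hq.lift_comp (f := Circle.exp) ⟨L, hL⟩ hlift)
  -- Winding number zero lets the logarithm descend to the circle; Tietze's theorem then extends it
  -- from the closed curve.
  obtain ⟨g, hg⟩ := ℓ.exists_extension' (hγ.isClosedEmbedding hi)
  refine ⟨g, g.continuous, fun z => ?_⟩
  obtain ⟨t, rfl⟩ := Circle.exp_surjective z
  refine (hcL t).trans ?_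
  rw [← hℓ]
  congr 1
  exact (congrFun hg _).symm

/-- If a relatively clopen nonempty part of the complement of a Jordan curve is removed, the index
is constant on the rest. -/
theorem index_eq_zero_of_isOpen (hγ : Continuous γ) (hi : Function.Injective γ)
    {A B : Set Sphere2} (hA : IsOpen A) (hB : IsOpen B) (hAB : Disjoint A B)
    (hU : A ∪ B = (Set.range γ)ᶜ) {u v y : Sphere2} (hu : u ∈ A) (hv : v ∈ B) (hy : y ∈ B) :
    index γ v y = 0 := by
  classical
  have hE : ∀ {z}, z ∈ A ∨ z ∈ B ↔ z ∉ Set.range γ := fun {z} => by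
    rw [← Set.mem_union, hU]; rfl
  have huE := hE.1 (Or.inl hu)
  have hvE := hE.1 (Or.inr hv)
  have hyE := hE.1 (Or.inr hy)
  have hd : ∀ {z}, z ∈ A → z ∉ B := fun h h' => Set.disjoint_left.1 hAB h h'
  have huy : u ≠ y := fun h => hd hu (h ▸ hy)
  -- The exponents are chosen so that the product of powers below has winding number zero along the
  -- curve.
  set k := index γ v y with hk
  set l := -index γ u y with hl
  have hw := ((hasWindingNumber_index hγ huE hyE).zpow k).mul
    ((hasWindingNumber_index hγ hvE hyE).zpow l)
  rw [show k * index γ u y + l * index γ v y = 0 by rw [hk, hl]; ring] at hw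
  obtain ⟨ℓ, hℓ, hℓE⟩ := exists_log_extension hγ hi
    (c := fun z => mobius u y (γ z) ^ k * mobius v y (γ z) ^ l) hw
  -- The two formulas agree on the curve. The first has its possible zeros and poles at `v`, `y` in
  -- `B`, the second at `u` in `A` and at `y`, so `G` is continuous and nonvanishing off `y`.
  set G : Sphere2 → ℂ := fun z =>
    if z ∈ A then exp (ℓ z) * mobius v y z ^ (-l) else mobius u y z ^ k with hG
  have hG1 : ∀ z, z ∈ A ∪ Set.range γ → G z = exp (ℓ z) * mobius v y z ^ (-l) := by
    intro z hz
    by_cases hzA : z ∈ A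
    · simp [hG, hzA]
    · obtain ⟨c, rfl⟩ := hz.resolve_left hzA
      have := mobius_ne_zero (ne_of_notMem_range hvE c) (ne_of_notMem_range hyE c)
      simp only [hG, hzA, if_false, ← hℓE, mul_assoc, ← zpow_add₀ this, add_neg_cancel, zpow_zero,
        mul_one]
  have hG2 : ∀ z, z ∉ A → G z = mobius u y z ^ k := fun z hz => by simp [hG, hz]
  have hAc : ∀ {z}, z ∈ A ∪ Set.range γ ↔ z ∉ B := fun {z} => by
    have h1 := @hE z
    have h2 := @hd z
    simp only [Set.mem_union]
    tauto
  set N := mobiusInv u y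
  have hN : Continuous N := continuous_mobiusInv huy
  have hNy : ∀ ζ, N ζ ≠ y := mobiusInv_ne huy
  have hcont : Continuous fun ζ => G (N ζ) := by
    rw [← continuousOn_univ, ← Set.union_compl_self (N ⁻¹' A)]
    have h1 : ContinuousOn (fun ζ => G (N ζ)) (N ⁻¹' Bᶜ) := by
      have : ContinuousOn (fun ζ => exp (ℓ (N ζ)) * mobius v y (N ζ) ^ (-l)) (N ⁻¹' Bᶜ) := by
        refine ContinuousOn.mul (by fun_prop) fun ζ hζ => ContinuousAt.continuousWithinAt ?_
        refine ContinuousAt.zpow₀ ((continuousAt_mobius (hNy ζ)).comp hN.continuousAt) _ (Or.inl ?_)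
        exact mobius_ne_zero (fun h => hζ (h ▸ hv)) (hNy ζ)
      exact this.congr fun ζ hζ => hG1 _ (hAc.2 hζ)
    have h2 : ContinuousOn (fun ζ => G (N ζ)) (N ⁻¹' Aᶜ) := by
      have : ContinuousOn (fun ζ => mobius u y (N ζ) ^ k) (N ⁻¹' Aᶜ) := by
        refine fun ζ hζ => ContinuousAt.continuousWithinAt ?_
        refine ContinuousAt.zpow₀ ((continuousAt_mobius (hNy ζ)).comp hN.continuousAt) _ (Or.inl ?_)
        exact mobius_ne_zero (fun h => hζ (h ▸ hu)) (hNy ζ)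
      exact this.congr fun ζ hζ => hG2 _ hζ
    refine (h1.union_of_isClosed h2 (hB.isClosed_compl.preimage hN)
      (hA.isClosed_compl.preimage hN)).mono ?_
    exact Set.union_subset_union (fun ζ hζ => hd hζ) subset_rfl
  have hne : ∀ ζ, G (N ζ) ≠ 0 := by
    intro ζ
    by_cases hζ : N ζ ∈ A
    · rw [hG1 _ (Or.inl hζ)]
      exact mul_ne_zero (exp_ne_zero _)
        (zpow_ne_zero _ (mobius_ne_zero (fun h => hd hζ (h ▸ hv)) (hNy ζ)))
    · rw [hG2 _ hζ]
      exact zpow_ne_zero _ (mobius_ne_zero (fun h => hζ (h ▸ hu)) (hNy ζ))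
  obtain ⟨Λ, hΛ, hGΛ⟩ := exists_log hcont hne
  obtain ⟨M, hM⟩ := exists_expCover_mem huy.symm (hB.mem_nhds hy)
  -- The circle of radius `exp R` in the coordinate `mobius u y` lies in the part of `B` close to
  -- `y`, since `-R < M`.
  set R : ℝ := 1 - M
  have hloop : ∀ t : ℝ, exp (k * (R + t * I)) = exp (Λ (exp (R + t * I))) := by
    intro t
    rw [← hGΛ]
    change _ = G (expCover u y (R + t * I))
    have hmem : expCover u y (R + t * I) ∈ B := by
      rw [← neg_neg (R + t * I : ℂ), expCover_neg huy]
      exact hM _ (by simp [R])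
    rw [hG2 _ (fun h => hd h hmem), mobius_expCover huy, exp_int_mul]
  -- On this circle `G` is the `k`-th power of the coordinate, which winds `k` times; the global
  -- logarithm `Λ` makes the same loop wind zero times.
  have h1 : HasWindingNumber (fun t => exp (k * (R + t * I))) k :=
    ⟨fun t => k * (R + t * I), by fun_prop, fun t => rfl, fun t => by push_cast; ring⟩
  refine h1.unique ⟨fun t => Λ (exp (R + t * I)), by fun_prop, hloop, fun t => ?_⟩
  have : exp (R + (t + 2 * Real.pi : ℝ) * I) = exp (R + t * I) :=
    exp_eq_exp_iff_exists_int.2 ⟨1, by push_cast; ring⟩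
  simp only [this, Int.cast_zero, mul_zero, zero_mul, add_zero]

end Index

/-! ### Cross-ratios along the two arcs of a Jordan curve. -/

/-- The cross-ratio of `z`, `a`, `t`, `y`, as a function of `z` and `a`. -/
noncomputable def crossRatio (t y z a : Sphere2) : ℂ := 1 - mobius t y a * mobius y t z

/-- Up to a constant factor, the cross-ratio is `mobius a t` in the variable `z` and, by the
companion identity, `mobius z y` in the variable `a`. Its winding can thus be read in either
variable. -/
theorem mobius_eq_mul_crossRatio {t y z a : Sphere2} (hya : y ≠ a) (hyt : y ≠ t) (hz : z ≠ t) :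
    mobius a t z = mobius a t y * crossRatio t y z a := by
  rw [mobius_eq_mul hya hyt hz, crossRatio, mul_comm (mobius y t z)]

theorem mobius_eq_mul_crossRatio' {t y z a : Sphere2} (hz : t ≠ z) (hty : t ≠ y) (ha : a ≠ y) :
    mobius z y a = mobius z y t * crossRatio t y z a :=
  mobius_eq_mul hz hty ha

theorem crossRatio_ne_zero {t y z a : Sphere2} (hya : y ≠ a) (hyt : y ≠ t) (hz : z ≠ t)
    (hza : z ≠ a) : crossRatio t y z a ≠ 0 := by
  have := mobius_ne_zero hza hz
  rw [mobius_eq_mul_crossRatio hya hyt hz] at this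
  exact right_ne_zero_of_mul this

section Arc

variable {γ : Circle → Sphere2}

/-- The image of the arc of angle `σπ` that starts at `1`. -/
def arc (γ : Circle → Sphere2) (σ : ℝ) : Set Sphere2 :=
  (fun τ : unitInterval => γ (Circle.exp (σ * Real.pi * τ))) '' Set.univ

theorem isClosed_arc (hγ : Continuous γ) (σ : ℝ) : IsClosed (arc γ σ) :=
  (isCompact_univ.image (by fun_prop)).isClosed

theorem mem_arc (σ : ℝ) (τ : unitInterval) : γ (Circle.exp (σ * Real.pi * τ)) ∈ arc γ σ :=
  ⟨τ, trivial, rfl⟩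

theorem arc_subset (σ : ℝ) : arc γ σ ⊆ Set.range γ := by
  rintro _ ⟨τ, -, rfl⟩
  exact ⟨_, rfl⟩

theorem range_subset_arc_union : Set.range γ ⊆ arc γ 1 ∪ arc γ (-1) := by
  rintro _ ⟨z, rfl⟩
  obtain ⟨h1, h2⟩ := arg_mem_Ioc (z : ℂ)
  have hpi := Real.pi_pos
  rcases le_total 0 (arg z) with h | h
  · left
    refine ⟨⟨arg z / Real.pi, by positivity, (div_le_one hpi).2 h2⟩, trivial, ?_⟩
    simp only
    rw [one_mul, mul_div_cancel₀ _ hpi.ne', Circle.exp_arg]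
  · right
    refine ⟨⟨-arg z / Real.pi, div_nonneg (by linarith) hpi.le, (div_le_one hpi).2 (by linarith)⟩,
      trivial, ?_⟩
    simp only
    rw [show -1 * Real.pi * (-arg (z : ℂ) / Real.pi) = arg z by field_simp, Circle.exp_arg]

theorem arc_inter_subset (hi : Function.Injective γ) :
    arc γ 1 ∩ arc γ (-1) ⊆ {γ 1, γ (Circle.exp Real.pi)} := by
  rintro _ ⟨⟨τ, -, rfl⟩, ⟨τ', -, h⟩⟩
  have hpi := Real.pi_pos
  obtain ⟨m, hm⟩ := Circle.exp_eq_exp.1 (hi h)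
  have h1 : (τ : ℝ) + τ' = -2 * m := by
    have : Real.pi * ((τ : ℝ) + τ' + 2 * m) = 0 := by linear_combination -hm
    rcases mul_eq_zero.1 this with h | h
    · exact absurd h hpi.ne'
    · linarith
  have hτ := τ.2
  have hτ' := τ'.2
  have hm1 : (-1 : ℝ) ≤ m := by linarith [hτ.2, hτ'.2]
  have hm2 : (m : ℝ) ≤ 0 := by linarith [hτ.1, hτ'.1]
  have hm1' : -1 ≤ m := by exact_mod_cast hm1
  have hm2' : m ≤ 0 := by exact_mod_cast hm2
  obtain rfl | rfl : m = 0 ∨ m = -1 := by omega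
  · left
    have : (τ : ℝ) = 0 := by push_cast at h1; linarith [hτ.1, hτ'.1]
    simp [this]
  · right
    have : (τ : ℝ) = 1 := by push_cast at h1; linarith [hτ.2, hτ'.2]
    simp [this]

theorem exp_mul_pi {σ : ℝ} (hσ : σ = 1 ∨ σ = -1) :
    Circle.exp (σ * Real.pi) = Circle.exp Real.pi := by
  rcases hσ with rfl | rfl
  · rw [one_mul]
  · rw [Circle.exp_eq_exp]
    exact ⟨-1, by push_cast; ring⟩

/-- On the complement of an arc, the cross-ratio with the endpoints of the arc has a logarithm,
which is the variation of the logarithm of the cross-ratio along the arc. -/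
theorem exists_log_crossRatio (hγ : Continuous γ) {y : Sphere2} (hy : y ∉ Set.range γ) {σ : ℝ}
    (hσ : σ = 1 ∨ σ = -1) :
    ∃ ℓ : Sphere2 → ℂ, ContinuousOn ℓ (arc γ σ)ᶜ ∧
      (∀ z ∉ arc γ σ, crossRatio (γ 1) y z (γ (Circle.exp Real.pi)) = exp (ℓ z)) ∧
      ∀ z ∉ Set.range γ, ∀ L : ℝ → ℂ, Continuous L →
        (∀ t, crossRatio (γ 1) y z (γ (Circle.exp t)) = exp (L t)) →
        ℓ z = L (σ * Real.pi) - L 0 := by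
  classical
  have h1mem : γ 1 ∈ arc γ σ := by simpa using mem_arc (γ := γ) σ 0
  have hy1 := (ne_of_notMem_range hy 1).symm
  -- The last argument travels along the arc from `γ 1`, where the cross-ratio is `1`; it never
  -- vanishes because `z` is off the arc.
  let F : unitInterval × ↥((arc γ σ)ᶜ) → ℂ := fun x =>
    crossRatio (γ 1) y x.2 (γ (Circle.exp (σ * Real.pi * x.1)))
  have hF : Continuous F := by
    refine continuous_const.sub (Continuous.mul ?_ ?_)
    · exact (continuous_mobius_comp hγ (γ 1) hy).comp
        (f := fun x : unitInterval × ↥((arc γ σ)ᶜ) => Circle.exp (σ * Real.pi * x.1)) (by fun_prop)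
    · refine continuous_iff_continuousAt.2 fun x => ?_
      have hx : (x.2 : Sphere2) ≠ γ 1 := fun h => x.2.2 (h ▸ h1mem)
      exact (continuousAt_mobius hx).comp
        (f := fun x : unitInterval × ↥((arc γ σ)ᶜ) => (x.2 : Sphere2)) (by fun_prop)
  obtain ⟨L, hL, hFL, hL0⟩ := exists_log_homotopy hF
    (fun x => crossRatio_ne_zero (ne_of_notMem_range hy _).symm hy1
      (fun h => x.2.2 (h ▸ h1mem)) (fun h => x.2.2 (h ▸ mem_arc σ x.1)))
    (fun x => by simp [F, crossRatio, mobius_self])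
  refine ⟨fun z => if hz : z ∈ (arc γ σ)ᶜ then L (1, ⟨z, hz⟩) else 0, ?_, ?_, ?_⟩
  · rw [continuousOn_iff_continuous_domRestrict]
    have : Continuous fun x : ↥((arc γ σ)ᶜ) => L (1, x) := by fun_prop
    convert this using 2 with x
    exact dif_pos x.2
  · intro z hz
    have := hFL (1, ⟨z, hz⟩)
    simp only [F, Set.Icc.coe_one, mul_one, exp_mul_pi hσ] at this
    simp only [this, dif_pos (Set.mem_compl hz)]
  · intro z hz L' hL' hexp
    have hz' : z ∈ (arc γ σ)ᶜ := fun h => hz (arc_subset σ h)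
    obtain ⟨n, hn⟩ := exists_int_of_exp_eq'
      (A := fun τ : unitInterval => L (τ, ⟨z, hz'⟩))
      (B := fun τ : unitInterval => L' (σ * Real.pi * τ)) (by fun_prop) (by fun_prop)
      (fun τ => by rw [← hFL, ← hexp])
    have h0 := hn 0
    have h1 := hn 1
    simp only [hL0, Set.Icc.coe_zero, mul_zero, Set.Icc.coe_one, mul_one] at h0 h1
    simp only [dif_pos hz', h1]
    linear_combination -h0

/-- The indices of the points off a Jordan curve have no common divisor. -/
theorem not_forall_dvd_index (hγ : Continuous γ) (hi : Function.Injective γ) {y : Sphere2}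
    (hy : y ∉ Set.range γ) {n : ℕ} (hn : 2 ≤ n) : ¬ ∀ z ∉ Set.range γ, (n : ℤ) ∣ index γ z y := by
  classical
  intro hdvd
  set t := γ 1
  set s := γ (Circle.exp Real.pi)
  have hst : s ≠ t := by
    intro h
    have h1 : Circle.exp Real.pi = Circle.exp 0 := by rw [Circle.exp_zero]; exact hi h
    obtain ⟨m, hm⟩ := Circle.exp_eq_exp.1 h1
    have h2 : Real.pi * (1 - 2 * m) = 0 := by linear_combination hm
    have h3 : (1 - 2 * m : ℝ) = 0 := (mul_eq_zero.1 h2).resolve_left Real.pi_pos.ne'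
    have h4 : (1 - 2 * m : ℤ) = 0 := by exact_mod_cast h3
    omega
  have hyt : y ≠ t := (ne_of_notMem_range hy _).symm
  have hys : y ≠ s := (ne_of_notMem_range hy _).symm
  have hn0 : (n : ℂ) ≠ 0 := by exact_mod_cast (by omega : n ≠ 0)
  obtain ⟨ℓ, hℓ, hℓe, hℓL⟩ := exists_log_crossRatio hγ hy (Or.inl rfl)
  obtain ⟨ℓ', hℓ', hℓe', hℓL'⟩ := exists_log_crossRatio hγ hy (Or.inr rfl)
  -- The two logarithms differ by the variation of one logarithm around the whole curve, `2πi` times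
  -- the index of `z`. Divisibility by `n` makes this disappear after division by `n` and
  -- exponentiation.
  have hagree : ∀ z, z ∉ arc γ 1 → z ∉ arc γ (-1) → exp (ℓ z / n) = exp (ℓ' z / n) := by
    intro z h1 h2
    have hz : z ∉ Set.range γ := fun h => (range_subset_arc_union h).elim h1 h2
    have htz := ne_of_notMem_range hz 1
    obtain ⟨k, hk⟩ := hdvd z hz
    have hw : HasWindingNumber (fun τ => crossRatio t y z (γ (Circle.exp τ))) (n * k) := by
      have h3 := (hasWindingNumber_const (inv_ne_zero
        (mobius_ne_zero htz hyt.symm))).mul (hasWindingNumber_index hγ hz hy)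
      rw [zero_add, hk] at h3
      convert h3 using 2 with τ
      rw [mobius_eq_mul_crossRatio' (a := γ (Circle.exp τ)) htz hyt.symm (ne_of_notMem_range hy _),
        inv_mul_cancel_left₀ (mobius_ne_zero htz hyt.symm)]
    obtain ⟨L, hL, hexp, hinc⟩ := hw
    have h3 := hinc (-Real.pi)
    rw [show -Real.pi + 2 * Real.pi = Real.pi by ring] at h3
    have e1 := hℓL z hz L hL hexp
    have e2 := hℓL' z hz L hL hexp
    rw [one_mul] at e1
    rw [neg_one_mul] at e2
    rw [exp_eq_exp_iff_exists_int]
    refine ⟨k, ?_⟩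
    rw [e1, e2, h3]
    push_cast
    field_simp
    ring
  -- The glued function is an `n`-th root, continuous off `s` and `t`, of the cross-ratio as a
  -- function of `z`.
  set ρ : Sphere2 → ℂ := fun z => if z ∈ arc γ 1 then exp (ℓ' z / n) else exp (ℓ z / n) with hρ
  have hρ1 : ∀ z ∉ arc γ 1, ρ z = exp (ℓ z / n) := fun z hz => by simp [hρ, hz]
  have hρ2 : ∀ z ∉ arc γ (-1), ρ z = exp (ℓ' z / n) := fun z hz => by
    by_cases h : z ∈ arc γ 1
    · simp [hρ, h]
    · rw [hρ1 z h, hagree z h hz]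
  have hcov : ∀ z, z ≠ s → z ≠ t → z ∉ arc γ 1 ∨ z ∉ arc γ (-1) := by
    intro z hzs hzt
    by_contra! hc
    rcases arc_inter_subset hi hc with h | h
    exacts [hzt h, hzs h]
  have hρc : ∀ z, z ≠ s → z ≠ t → ContinuousAt ρ z := by
    intro z hzs hzt
    rcases hcov z hzs hzt with h | h
    · have hnh := (isClosed_arc hγ 1).isOpen_compl.mem_nhds h
      refine (((hℓ.continuousAt hnh).div_const (n : ℂ)).cexp).congr ?_
      filter_upwards [hnh] with w hw using (hρ1 w hw).symm
    · have hnh := (isClosed_arc hγ (-1)).isOpen_compl.mem_nhds h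
      refine (((hℓ'.continuousAt hnh).div_const (n : ℂ)).cexp).congr ?_
      filter_upwards [hnh] with w hw using (hρ2 w hw).symm
  have hρn : ∀ z, z ≠ s → z ≠ t → ρ z ^ (n : ℤ) = crossRatio t y z s := by
    intro z hzs hzt
    rcases hcov z hzs hzt with h | h
    · rw [hρ1 z h, hℓe z h, ← exp_int_mul]
      congr 1; push_cast; field_simp
    · rw [hρ2 z h, hℓe' z h, ← exp_int_mul]
      congr 1; push_cast; field_simp
  -- On the unit circle of the coordinate `mobius s t` the cross-ratio winds once around `0`, so its
  -- `n`-th root would have winding number `j` with `n * j = 1`.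
  have hs' : ∀ x : ℝ, expCover s t (x * I) ≠ s := fun x => expCover_ne_left hst _
  have ht' : ∀ x : ℝ, expCover s t (x * I) ≠ t := fun x => expCover_ne_right hst _
  have hcont : Continuous fun x : ℝ => ρ (expCover s t (x * I)) :=
    continuous_iff_continuousAt.2 fun x => (hρc _ (hs' x) (ht' x)).comp
      (f := fun x : ℝ => expCover s t (x * I))
      ((continuous_expCover hst).comp (by fun_prop)).continuousAt
  obtain ⟨j, hj⟩ := exists_hasWindingNumber hcont
    (fun x => by
      rcases hcov _ (hs' x) (ht' x) with h | h
      · rw [hρ1 _ h]; exact exp_ne_zero _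
      · rw [hρ2 _ h]; exact exp_ne_zero _)
    (fun x => by
      have := expCover_add_int (u := s) (v := t) (x * I) 1
      rw [← this]
      congr 2
      push_cast; ring)
  have h1 := hj.zpow n
  have h2 := (hasWindingNumber_const (inv_ne_zero (mobius_ne_zero hys hyt))).mul
    hasWindingNumber_exp
  have h3 : (n : ℤ) * j = 0 + 1 := by
    refine h1.unique ?_
    convert h2 using 2 with x
    rw [hρn _ (hs' x) (ht' x), ← mobius_expCover hst,
      mobius_eq_mul_crossRatio hys hyt (ht' x), inv_mul_cancel_left₀ (mobius_ne_zero hys hyt)]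
  have h4 : (n : ℤ) ∣ 1 := ⟨j, by omega⟩
  have := Int.le_of_dvd one_pos h4
  omega

/-- A circle minus two points is disconnected, whereas the sphere minus two points is the image of
`ℂ` under `expCover`, hence connected. -/
theorem exists_notMem_range (hγ : Continuous γ) (hi : Function.Injective γ) :
    ∃ y, y ∉ Set.range γ := by
  by_contra! hall
  have hne : (1 : Circle) ≠ Circle.exp Real.pi := by
    intro h
    have h2 := congrArg (fun z : Circle => (z : ℂ)) h
    norm_num at h2
  have hst : γ 1 ≠ γ (Circle.exp Real.pi) := fun h => hne (hi h)
  apply Circle.not_isPreconnected_compl_pair hne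
  have hemb := hγ.isClosedEmbedding hi
  rw [← hemb.isInducing.isPreconnected_image]
  have : γ '' {1, Circle.exp Real.pi}ᶜ =
      Set.range (expCover (γ 1) (γ (Circle.exp Real.pi))) := by
    ext z
    constructor
    · rintro ⟨c, hc, rfl⟩
      simp only [Set.mem_compl_iff, Set.mem_insert_iff, Set.mem_singleton_iff, not_or] at hc
      have h1 : γ c ≠ γ 1 := fun h => hc.1 (hi h)
      have h2 : γ c ≠ γ (Circle.exp Real.pi) := fun h => hc.2 (hi h)
      exact ⟨log (mobius _ _ (γ c)),
        expCover_eq_of_mobius hst h2 (exp_log (mobius_ne_zero h1 h2)).symm⟩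
    · rintro ⟨x, rfl⟩
      obtain ⟨c, hc⟩ := hall (expCover (γ 1) (γ (Circle.exp Real.pi)) x)
      refine ⟨c, ?_, hc⟩
      rintro (rfl | h)
      · exact expCover_ne_left hst x hc.symm
      · rw [Set.mem_singleton_iff] at h
        subst h
        exact expCover_ne_right hst x hc.symm
  rw [this]
  exact isPreconnected_range (continuous_expCover hst)

/-! ### The Jordan curve theorem. -/

/-- The two sides of a Jordan curve. -/
structure AreSides (γ : Circle → Sphere2) (U V : Set Sphere2) : Prop where
  isOpen_left : IsOpen U
  isOpen_right : IsOpen V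
  disjoint : Disjoint U V
  union_eq : U ∪ V = (Set.range γ)ᶜ
  nonempty_left : U.Nonempty
  nonempty_right : V.Nonempty
  isPreconnected_left : IsPreconnected U
  isPreconnected_right : IsPreconnected V
  index_left : ∀ u ∈ U, ∀ u' ∈ U, index γ u u' = 0
  index_right : ∀ v ∈ V, ∀ v' ∈ V, index γ v v' = 0
  index_eq : ∀ u ∈ U, ∀ v ∈ V, index γ u v = 1 ∨ index γ u v = -1

/-- If `U` split into two open pieces, removing one of them would force index zero between the other
and `V`, by `index_eq_zero_of_isOpen`. -/
theorem isPreconnected_side (hγ : Continuous γ) (hi : Function.Injective γ) {U V : Set Sphere2}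
    (hU : IsOpen U) (hV : IsOpen V) (hd : Disjoint U V) (hUV : U ∪ V = (Set.range γ)ᶜ)
    (hne : V.Nonempty) (hidx : ∀ u ∈ U, ∀ v ∈ V, index γ u v ≠ 0) : IsPreconnected U := by
  rintro A B hA hB hsub ⟨a, haU, haA⟩ ⟨b, hbU, hbB⟩
  by_contra hc
  rw [Set.not_nonempty_iff_eq_empty, Set.eq_empty_iff_forall_notMem] at hc
  obtain ⟨v, hv⟩ := hne
  have hdis : ∀ z, z ∈ U → z ∉ V := fun z hz => Set.disjoint_left.1 hd hz
  refine hidx b hbU v hv (index_eq_zero_of_isOpen hγ hi (hU.inter hA) ((hU.inter hB).union hV)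
    ?_ ?_ ⟨haU, haA⟩ (Or.inl ⟨hbU, hbB⟩) (Or.inr hv))
  · rw [Set.disjoint_left]
    rintro z ⟨hzU, hzA⟩ (⟨-, hzB⟩ | hzV)
    exacts [hc z ⟨hzU, hzA, hzB⟩, hdis z hzU hzV]
  · rw [← Set.union_assoc, ← Set.inter_union_distrib_left, Set.inter_eq_left.2 hsub, hUV]

/-- The Jordan curve theorem, in terms of indices. -/
theorem exists_areSides (hγ : Continuous γ) (hi : Function.Injective γ) :
    ∃ U V, AreSides γ U V := by
  obtain ⟨y, hy⟩ := exists_notMem_range hγ hi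
  have hJ := fun n hn => not_forall_dvd_index (n := n) hγ hi hy hn
  obtain ⟨z, hz, hz2⟩ : ∃ z, z ∉ Set.range γ ∧ index γ z y ≠ 0 := by
    by_contra! hc
    exact hJ 2 le_rfl fun z hz => by rw [hc z hz]; exact dvd_zero _
  set V : Set Sphere2 := {u | u ∉ Set.range γ ∧ index γ u y = 0} with hVdef
  set U : Set Sphere2 := {u | u ∉ Set.range γ ∧ index γ u y ≠ 0} with hUdef
  have hV : IsOpen V := isOpen_index_eq hγ hy 0
  have hU : IsOpen U := by
    have : U = ⋃ n : {n : ℤ // n ≠ 0}, {u | u ∉ Set.range γ ∧ index γ u y = n} := by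
      ext u
      simp only [hUdef, Set.mem_ofPred_eq, Set.mem_iUnion, Subtype.exists]
      grind
    rw [this]
    exact isOpen_iUnion fun n => isOpen_index_eq hγ hy n
  have hd : Disjoint U V := Set.disjoint_left.2 fun u hu hv => hu.2 hv.2
  have hUV : U ∪ V = (Set.range γ)ᶜ := by
    ext u
    simp only [hUdef, hVdef, Set.mem_union, Set.mem_ofPred_eq, Set.mem_compl_iff]
    tauto
  have hyV : y ∈ V := ⟨hy, index_self hγ hy⟩
  have hzU : z ∈ U := ⟨hz, hz2⟩
  have hleft : ∀ u ∈ U, ∀ u' ∈ U, index γ u u' = 0 := fun u hu u' hu' =>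
    index_eq_zero_of_isOpen hγ hi hV hU hd.symm (by rw [Set.union_comm, hUV]) hyV hu hu'
  have hright : ∀ v ∈ V, ∀ v' ∈ V, index γ v v' = 0 := fun v hv v' hv' => by
    have := index_add hγ hv.1 hv'.1 hy
    rw [hv.2, hv'.2] at this
    omega
  have hconst : ∀ u ∈ U, ∀ v ∈ V, index γ u v = index γ z y := fun u hu v hv => by
    have h1 := index_add hγ hu.1 hz hv.1
    have h2 := index_add hγ hz hy hv.1
    rw [hleft u hu z hzU] at h1
    rw [hright y hyV v hv] at h2
    omega
  -- Indices relative to `y` take only the values `0` and `index γ z y`, so the absolute value of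
  -- the latter divides them all.
  have hone : index γ z y = 1 ∨ index γ z y = -1 := by
    by_contra! hc
    refine hJ (index γ z y).natAbs (by omega) fun w hw => ?_
    by_cases h0 : index γ w y = 0
    · rw [h0]; exact dvd_zero _
    · rw [hconst w ⟨hw, h0⟩ y hyV]; simp
  refine ⟨U, V, hU, hV, hd, hUV, ⟨z, hzU⟩, ⟨y, hyV⟩, ?_, ?_, hleft, hright, ?_⟩
  · exact isPreconnected_side hγ hi hU hV hd hUV ⟨y, hyV⟩
      fun u hu v hv => by rw [hconst u hu v hv]; exact hz2
  · refine isPreconnected_side hγ hi hV hU hd.symm (by rw [Set.union_comm, hUV]) ⟨z, hzU⟩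
      fun v hv u hu => ?_
    rw [index_neg hγ hv.1 hu.1, hconst u hu v hv]
    simpa using hz2
  · intro u hu v hv
    rw [hconst u hu v hv]
    exact hone

end Arc

namespace AreSides

variable {γ : Circle → Sphere2} {U V : Set Sphere2}

theorem left_notMem (h : AreSides γ U V) {u : Sphere2} (hu : u ∈ U) : u ∉ Set.range γ := by
  have : u ∈ (Set.range γ)ᶜ := h.union_eq ▸ Or.inl hu
  exact this

theorem right_notMem (h : AreSides γ U V) {v : Sphere2} (hv : v ∈ V) : v ∉ Set.range γ := by
  have : v ∈ (Set.range γ)ᶜ := h.union_eq ▸ Or.inr hv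
  exact this

theorem symm (hγ : Continuous γ) (h : AreSides γ U V) : AreSides γ V U where
  isOpen_left := h.isOpen_right
  isOpen_right := h.isOpen_left
  disjoint := h.disjoint.symm
  union_eq := by rw [Set.union_comm, h.union_eq]
  nonempty_left := h.nonempty_right
  nonempty_right := h.nonempty_left
  isPreconnected_left := h.isPreconnected_right
  isPreconnected_right := h.isPreconnected_left
  index_left := h.index_right
  index_right := h.index_left
  index_eq v hv u hu := by
    rw [index_neg hγ (h.right_notMem hv) (h.left_notMem hu)]
    have := h.index_eq u hu v hv
    omega

theorem mem_or_mem (h : AreSides γ U V) {z : Sphere2} (hz : z ∉ Set.range γ) : z ∈ U ∨ z ∈ V := by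
  have : z ∈ U ∪ V := h.union_eq ▸ hz
  exact this

theorem notMem_right (h : AreSides γ U V) {z : Sphere2} (hz : z ∈ U) : z ∉ V :=
  Set.disjoint_left.1 h.disjoint hz

theorem ne (h : AreSides γ U V) {u v : Sphere2} (hu : u ∈ U) (hv : v ∈ V) : u ≠ v :=
  fun e => h.notMem_right hu (e ▸ hv)

end AreSides

/-! ### Retraction of the universal covering onto a closed side. -/

/-- The universal covering of the twice punctured sphere can be retracted onto the closure of
one side of a Jordan curve separating the two punctures. -/
theorem AreSides.exists_retracted_expCover {γ : Circle → Sphere2} {U V : Set Sphere2}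
    (h : AreSides γ U V) (hγ : Continuous γ) (hi : Function.Injective γ) {p q : Sphere2}
    (hp : p ∈ U) (hq : q ∈ V) :
    ∃ Φ : ℂ → Sphere2, Continuous Φ ∧ (∀ s, Φ s ∈ U ∪ Set.range γ) ∧ (∀ s, Φ s ≠ p) ∧
      (∀ s (n : ℤ), Φ (s + 2 * Real.pi * n * I) = Φ s) ∧
      ∀ s, expCover p q s ∈ U ∪ Set.range γ → Φ s = expCover p q s := by
  classical
  have hpq := h.ne hp hq
  have hpE := h.left_notMem hp
  have hqE := h.right_notMem hq
  set ε := index γ p q with hε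
  have hεε : (ε : ℝ) * ε = 1 := by
    rcases h.index_eq p hp q hq with h' | h' <;> simp [hε, h']
  set e := expCover p q with he
  have hec : Continuous e := continuous_expCover hpq
  -- The factor `z ^ (-ε)` cancels the winding of the curve. The extended `ℓ` thus measures how far
  -- the logarithm of `mobius p q` on the curve is from `ε` times the parameter angle.
  have hw := (hasWindingNumber_index hγ hpE hqE).mul (hasWindingNumber_exp.zpow (-ε))
  rw [← hε, show ε + -ε * 1 = 0 by ring] at hw
  obtain ⟨ℓ, hℓ, hℓE⟩ := exists_log_extension hγ hi
    (c := fun z => mobius p q (γ z) * (z : ℂ) ^ (-ε)) (by simpa only [Circle.coe_exp] using hw)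
  have hkey : ∀ s z, e s = γ z → Circle.exp (ε * (s - ℓ (e s)).im) = z := by
    intro s z hsz
    obtain ⟨t, rfl⟩ := Circle.exp_surjective z
    have h1 := hℓE (Circle.exp t)
    rw [← hsz, he, mobius_expCover hpq, Circle.coe_exp, ← exp_int_mul, ← Complex.exp_add,
      exp_eq_exp_iff_exists_int] at h1
    obtain ⟨n, hn⟩ := h1
    have h2 : s - ℓ (e s) = ((ε * t + 2 * Real.pi * n : ℝ) : ℂ) * I := by
      push_cast at hn ⊢
      linear_combination hn
    have h3 : (s - ℓ (e s)).im = ε * t + 2 * Real.pi * n := by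
      rw [h2]; simp
    rw [h3, Circle.exp_eq_exp]
    refine ⟨ε * n, ?_⟩
    push_cast
    linear_combination t * hεε
  -- Outside `U` the point is sent to the curve, with angle read from `s - ℓ (e s)`. On the curve
  -- this recovers the point itself, and a shift of `s` by `2πi` changes the angle by `2πε`, so
  -- periodicity is kept.
  set Φ : ℂ → Sphere2 := fun s => if e s ∈ U ∪ Set.range γ then e s else
    γ (Circle.exp (ε * (s - ℓ (e s)).im)) with hΦ
  have hΦ1 : ∀ s, e s ∈ U ∪ Set.range γ → Φ s = e s := fun s hs => by
    simp only [hΦ, if_pos hs]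
  have hΦ2 : ∀ s, e s ∉ U → Φ s = γ (Circle.exp (ε * (s - ℓ (e s)).im)) := by
    intro s hs
    by_cases hE : e s ∈ Set.range γ
    · obtain ⟨z, hz⟩ := hE
      rw [hΦ1 s (Or.inr ⟨z, hz⟩), hkey s z hz.symm, hz]
    · simp only [hΦ]
      rw [if_neg]
      exact fun h => h.elim hs hE
  have hcl : U ∪ Set.range γ = Vᶜ := by
    ext z
    have h1 := @AreSides.mem_or_mem _ _ _ h z
    have h2 := @AreSides.notMem_right _ _ _ h z
    have h3 := @AreSides.right_notMem _ _ _ h z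
    simp only [Set.mem_union, Set.mem_compl_iff]
    tauto
  refine ⟨Φ, ?_, ?_, ?_, ?_, hΦ1⟩
  · have h1 : ContinuousOn Φ (e ⁻¹' Vᶜ) :=
      hec.continuousOn.congr fun s hs => hΦ1 s (by rw [hcl]; exact hs)
    have h2 : ContinuousOn Φ (e ⁻¹' Uᶜ) := by
      have : Continuous fun s => γ (Circle.exp (ε * (s - ℓ (e s)).im)) := by fun_prop
      exact this.continuousOn.congr fun s hs => hΦ2 s hs
    rw [← continuousOn_univ]
    refine (h1.union_of_isClosed h2 (h.isOpen_right.isClosed_compl.preimage hec)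
      (h.isOpen_left.isClosed_compl.preimage hec)).mono fun s _ => ?_
    by_cases hs : e s ∈ U
    · exact Or.inl (h.notMem_right hs)
    · exact Or.inr hs
  · intro s
    by_cases hs : e s ∈ U
    · rw [hΦ1 s (Or.inl hs)]; exact Or.inl hs
    · rw [hΦ2 s hs]; exact Or.inr ⟨_, rfl⟩
  · intro s
    by_cases hs : e s ∈ U
    · rw [hΦ1 s (Or.inl hs)]; exact expCover_ne_left hpq s
    · rw [hΦ2 s hs]; exact ne_of_notMem_range hpE _
  · intro s n
    have hes : e (s + 2 * Real.pi * n * I) = e s := expCover_add_int s n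
    by_cases hs : e s ∈ U
    · rw [hΦ1 s (Or.inl hs), hΦ1 _ (by rw [hes]; exact Or.inl hs), hes]
    · rw [hΦ2 s hs, hΦ2 _ (by rwa [hes]), hes]
      congr 1
      rw [Circle.exp_eq_exp]
      refine ⟨ε * n, ?_⟩
      simp
      ring

/-! ### Topology of branched coverings. -/

namespace IsBranchedCovering

variable {f : Sphere2 → Sphere2}

/-- In the charts the map is `z ↦ z ^ d`; a `d`-th root of a value of norm less than `r ^ d` has
norm less than `r`. -/
theorem isOpenMap (hf : IsBranchedCovering f) : IsOpenMap f := by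
  rw [isOpenMap_iff_nhds_le]
  intro p A hA
  obtain ⟨d, φ, ψ, hd, -, -, hp, hfp, hφ, hψ, hloc⟩ := hf.2 p
  have h1 : φ '' (φ.source ∩ f ⁻¹' A) ∈ 𝓝 (0 : ℂ) := by
    rw [← hφ, ← φ.map_nhds_eq hp]
    exact image_mem_map (inter_mem (φ.open_source.mem_nhds hp) hA)
  obtain ⟨r, hr, hball⟩ := Metric.mem_nhds_iff.1 h1
  have h2 : ψ ⁻¹' Metric.ball 0 (r ^ d) ∈ 𝓝 (f p) := by
    apply ψ.continuousAt hfp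
    rw [hψ]
    exact Metric.ball_mem_nhds _ (by positivity)
  filter_upwards [h2, ψ.open_source.mem_nhds hfp] with y hy hys
  have hd0 : d ≠ 0 := by omega
  set ζ : ℂ := ψ y ^ (d⁻¹ : ℂ)
  have hζ : ζ ^ d = ψ y := cpow_nat_inv_pow _ hd0
  have hζr : ζ ∈ Metric.ball (0 : ℂ) r := by
    have : ψ y ∈ Metric.ball (0 : ℂ) (r ^ d) := hy
    rw [mem_ball_zero_iff, ← hζ, norm_pow] at this
    rw [mem_ball_zero_iff]
    exact lt_of_pow_lt_pow_left₀ d hr.le this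
  obtain ⟨x, ⟨hxs, hxA⟩, hx⟩ := hball hζr
  obtain ⟨h3, h4⟩ := hloc x hxs
  rw [hx, hζ] at h4
  rw [← ψ.injOn h3 hys h4]
  exact hxA

theorem eventually_ne (hf : IsBranchedCovering f) (x : Sphere2) : ∀ᶠ y in 𝓝[≠] x, f y ≠ f x := by
  obtain ⟨d, φ, ψ, hd, -, -, hp, hfp, hφ, hψ, hloc⟩ := hf.2 x
  filter_upwards [self_mem_nhdsWithin, nhdsWithin_le_nhds (φ.open_source.mem_nhds hp)] with y hy hys h
  apply hy
  apply φ.injOn hys hp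
  have := (hloc y hys).2
  rw [h, hψ] at this
  rw [hφ]
  exact pow_eq_zero_iff (by omega) |>.1 this.symm

theorem surjective (hf : IsBranchedCovering f) : Function.Surjective f := by
  rw [← Set.range_eq_univ]
  exact IsClopen.eq_univ ⟨hf.1.isClosedMap.isClosed_range, hf.isOpenMap.isOpen_range⟩
    (Set.range_nonempty f)

end IsBranchedCovering

theorem exists_injOn_of_notMem {f : Sphere2 → Sphere2} {x : Sphere2}
    (hx : f x ∉ postcriticalSet f) : ∃ N ∈ 𝓝 x, Set.InjOn f N := by
  by_contra! hc
  apply hx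
  simp only [postcriticalSet, Set.mem_iUnion]
  exact ⟨1, le_rfl, x, hc, rfl⟩

theorem map_mem_postcriticalSet {f : Sphere2 → Sphere2} {x : Sphere2}
    (hx : x ∈ postcriticalSet f) : f x ∈ postcriticalSet f := by
  simp only [postcriticalSet, Set.mem_iUnion] at hx ⊢
  obtain ⟨n, -, c, hc, rfl⟩ := hx
  exact ⟨n + 1, by omega, c, hc, Function.iterate_succ_apply' f n c⟩

/-- Over a non-postcritical value the map is locally injective, continuous and open, hence a local
homeomorphism; compactness of the sphere does the rest. -/
theorem IsBranchedCovering.isCoveringMapOn {f : Sphere2 → Sphere2} (hf : IsBranchedCovering f) :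
    IsCoveringMapOn f (postcriticalSet f)ᶜ := by
  refine IsCoveringMapOn.of_isLocalHomeomorphOn hf.1 (IsLocalHomeomorphOn.mk f _ fun x hx => ?_)
  obtain ⟨N, hN, hinj⟩ := exists_injOn_of_notMem hx
  obtain ⟨O, hON, hO, hxO⟩ := mem_nhds_iff.1 hN
  exact ⟨OpenPartialHomeomorph.ofContinuousOpen ((hinj.mono hON).toPartialEquiv f O)
    hf.1.continuousOn hf.isOpenMap hO, hxO, fun y _ => rfl⟩

/-- Uniqueness of lifts away from the critical points. -/
theorem eq_of_comp_eq {f : Sphere2 → Sphere2} {Y : Type*} [TopologicalSpace Y]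
    [PreconnectedSpace Y] {g h : Y → Sphere2} (hg : Continuous g) (hh : Continuous h)
    (hfgh : ∀ y, f (g y) = f (h y)) (hP : ∀ y, f (g y) ∉ postcriticalSet f) {y₀ : Y}
    (h0 : g y₀ = h y₀) (y : Y) : g y = h y := by
  have hclopen : IsClopen {y | g y = h y} := by
    refine ⟨isClosed_eq hg hh, isOpen_iff_mem_nhds.2 fun y hy => ?_⟩
    obtain ⟨N, hN, hinj⟩ := exists_injOn_of_notMem (hP y)
    have hN' : N ∈ 𝓝 (h y) := by rwa [← show g y = h y from hy]
    filter_upwards [hg.continuousAt hN, hh.continuousAt hN'] with z hz hz'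
    exact hinj hz hz' (hfgh z)
  have := hclopen.eq_univ ⟨y₀, h0⟩
  exact Set.eq_univ_iff_forall.1 this y

/-! ### Fibres over a side with at most one postcritical point. -/

theorem log_add_int_mul {L : ℝ → ℂ} {k : ℤ}
    (hL : ∀ t, L (t + 2 * Real.pi) = L t + 2 * Real.pi * k * I) (m : ℤ) (t : ℝ) :
    L (t + m * (2 * Real.pi)) = L t + 2 * Real.pi * (m * k : ℤ) * I := by
  induction m using Int.induction_on generalizing t with
  | zero => simp
  | succ i ih =>
    have h1 := ih (t + 2 * Real.pi)
    rw [hL] at h1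
    rw [show t + ((i : ℤ) + 1 : ℤ) * (2 * Real.pi) = t + 2 * Real.pi + (i : ℤ) * (2 * Real.pi) by
      push_cast; ring, h1]
    push_cast; ring
  | pred i ih =>
    have h1 := ih (t - 2 * Real.pi)
    have h2 := hL (t - 2 * Real.pi)
    rw [sub_add_cancel] at h2
    rw [show t + (-(i : ℤ) - 1 : ℤ) * (2 * Real.pi) =
      t - 2 * Real.pi + (-(i : ℤ) : ℤ) * (2 * Real.pi) by push_cast; ring, h1, h2]
    push_cast; ring

/-- If a branched covering has at most one postcritical point `p` on one side of a Jordan curve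
with a connected preimage curve, then `p` has at most one preimage. -/
theorem IsBranchedCovering.subsingleton_fiber {f : Sphere2 → Sphere2} (hf : IsBranchedCovering f)
    {γ δ : Circle → Sphere2} (hγ : Continuous γ) (hi : Function.Injective γ) (hδ : Continuous δ)
    (hδr : Set.range δ = f ⁻¹' Set.range γ) {θ : ℝ → ℝ} (hθ : Continuous θ)
    (hfδ : ∀ t, f (δ (Circle.exp t)) = γ (Circle.exp (θ t)))
    (hdisj : Disjoint (Set.range γ) (postcriticalSet f)) {U V : Set Sphere2}
    (h : AreSides γ U V) {p q : Sphere2} (hp : p ∈ U) (hq : q ∈ V)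
    (hPU : ∀ z ∈ U, z ∈ postcriticalSet f → z = p) : (f ⁻¹' {p}).Subsingleton := by
  intro x₁ hx₁ x₂ hx₂
  by_contra hne
  have hpq := h.ne hp hq
  obtain ⟨Φ, hΦ, hΦmem, hΦp, hΦper, hΦe⟩ := h.exists_retracted_expCover hγ hi hp hq
  have hΦP : ∀ s, Φ s ∉ postcriticalSet f := fun s hs =>
    (hΦmem s).elim (fun hU => hΦp s (hPU _ hU hs)) (fun hE => Set.disjoint_left.1 hdisj hE hs)
  obtain ⟨L, hL, hLexp, hLinc⟩ := hasWindingNumber_index hγ (h.left_notMem hp) (h.right_notMem hq)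
  have hΦL : ∀ t, Φ (L t) = γ (Circle.exp t) := fun t => by
    have h1 : expCover p q (L t) = γ (Circle.exp t) :=
      expCover_eq_of_mobius hpq (ne_of_notMem_range (h.right_notMem hq) _) (hLexp t)
    rw [hΦe _ (by rw [h1]; exact Or.inr ⟨_, rfl⟩), h1]
  -- Every lift of `Φ` through `f` contains the one preimage curve `δ` above the boundary, so any
  -- two lifts agree up to vertical translations.
  have hlift : ∀ s x, f x = Φ s → ∃ Ψ : ℂ → Sphere2, Continuous Ψ ∧ Ψ s = x ∧
      (∀ s, f (Ψ s) = Φ s) ∧ ∃ j : ℤ, ∀ t, Ψ (L (θ t) + 2 * Real.pi * j * I) = δ (Circle.exp t) := by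
    intro s x hx
    obtain ⟨Ψ, ⟨hΨs, hΨ⟩, -⟩ := hf.isCoveringMapOn.existsUnique_continuousMap_lifts
      ⟨Φ, hΦ⟩ (a₀ := s) (e₀ := x) hx hΦP
    have hfΨ : ∀ s, f (Ψ s) = Φ s := fun s => congrFun hΨ s
    refine ⟨Ψ, Ψ.continuous, hΨs, hfΨ, ?_⟩
    have h1 : Ψ (L (θ 0)) ∈ Set.range δ := by
      rw [hδr, Set.mem_preimage, hfΨ, hΦL]
      exact ⟨_, rfl⟩
    obtain ⟨c, hc⟩ := h1
    obtain ⟨τ, rfl⟩ := Circle.exp_surjective c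
    have h2 : γ (Circle.exp (θ 0)) = γ (Circle.exp (θ τ)) := by
      rw [← hΦL, ← hfΨ, ← hc, hfδ]
    obtain ⟨m, hm⟩ := Circle.exp_eq_exp.1 (hi h2)
    -- With this shift, the argument of `Ψ` at `t = τ` is `L (θ τ + 2πm) = L (θ 0)`, where the lift
    -- meets `δ (Circle.exp τ)`.
    refine ⟨m * index γ p q, eq_of_comp_eq (f := f) (y₀ := τ) ?_ ?_ ?_ ?_ ?_⟩
    · fun_prop
    · fun_prop
    · intro t
      rw [hfΨ, hΦper, hΦL, hfδ]
    · intro t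
      rw [hfΨ]
      exact hΦP _
    · rw [← log_add_int_mul hLinc m, ← hm, hc]
  obtain ⟨N, hN, hNF⟩ : ∃ N ∈ 𝓝 x₁, ∀ y ∈ N, f y = p → y = x₁ := by
    have := eventually_nhdsWithin_iff.1 (hf.eventually_ne x₁)
    refine ⟨_, this, fun y hy hfy => ?_⟩
    by_contra hyx
    exact hy hyx (by rw [hfy]; exact hx₁.symm)
  obtain ⟨C, hC, hCclosed, hCN⟩ := exists_mem_nhds_isClosed_subset hN
  set W₁ := interior C
  set W₂ := Cᶜ
  have hW₁ : IsOpen W₁ := isOpen_interior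
  have hW₂ : IsOpen W₂ := hCclosed.isOpen_compl
  have hW : Disjoint W₁ W₂ := Set.disjoint_left.2 fun z hz hz' => hz' (interior_subset hz)
  have hx₁W : x₁ ∈ W₁ := mem_interior_iff_mem_nhds.2 hC
  have hx₂W : x₂ ∈ W₂ := fun hx => hne (hNF x₂ (hCN hx) hx₂).symm
  have hfib : ∀ x, f x = p → x ∈ W₁ ∪ W₂ := by
    intro x hx
    by_cases hxC : x ∈ C
    · rw [hNF x (hCN hxC) hx]; exact Or.inl hx₁W
    · exact Or.inr hxC
  -- A neighbourhood of `p` whose whole preimage lies in `W₁ ∪ W₂`; it is open because `f` is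
  -- closed.
  set D : Set Sphere2 := (f '' (W₁ ∪ W₂)ᶜ)ᶜ
  have hD : IsOpen D := (hf.1.isClosedMap _ (hW₁.union hW₂).isClosed_compl).isOpen_compl
  have hpD : p ∈ D := fun ⟨x, hx, hfx⟩ => hx (hfib x hfx)
  have hDW : ∀ x, f x ∈ D → x ∈ W₁ ∪ W₂ := fun x hx => by
    by_contra hc
    exact hx ⟨x, hc, rfl⟩
  obtain ⟨M, hM⟩ := exists_expCover_mem hpq ((hD.inter h.isOpen_left).mem_nhds ⟨hpD, hp⟩)
  have hΦM : ∀ s : ℂ, s.re < M → Φ s ∈ D := fun s hs => by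
    rw [hΦe s (Or.inl (hM s hs).2)]
    exact (hM s hs).1
  have hhalf : IsPreconnected {s : ℂ | s.re < M} := (convex_halfSpace_re_lt M).isPreconnected
  have hstart : ∀ x W, f x = p → IsOpen W → x ∈ W → ∃ s : ℂ, s.re < M ∧ ∃ y ∈ W, f y = Φ s := by
    intro x W hx hWo hxW
    have hO : ∀ᶠ z in 𝓝 p, z ∈ U ∧ ‖mobius p q z‖ < Real.exp M := by
      refine Filter.Eventually.and (h.isOpen_left.mem_nhds hp) ?_
      have := (continuousAt_mobius (u := p) hpq).norm
      refine this.eventually_lt continuousAt_const ?_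
      rw [mobius_self, norm_zero]
      exact Real.exp_pos M
    have hO' : ∀ᶠ y in 𝓝 x, f y ∈ U ∧ ‖mobius p q (f y)‖ < Real.exp M := by
      have := hf.1.tendsto x
      rw [hx] at this
      exact this.eventually hO
    obtain ⟨y, ⟨hyU, hyM⟩, hyW, hyp⟩ := ((hO'.filter_mono nhdsWithin_le_nhds).and
      ((eventually_nhdsWithin_of_eventually_nhds (hWo.mem_nhds hxW)).and
        (hf.eventually_ne x))).exists
    rw [hx] at hyp
    have hyq : f y ≠ q := h.ne hyU hq
    have h0 := mobius_ne_zero hyp hyq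
    refine ⟨log (mobius p q (f y)), ?_, y, hyW, ?_⟩
    · rw [log_re]
      exact (Real.log_lt_iff_lt_exp (norm_pos_iff.2 h0)).2 hyM
    · have h1 : expCover p q (log (mobius p q (f y))) = f y :=
        expCover_eq_of_mobius hpq hyq (exp_log h0).symm
      rw [hΦe _ (by rw [h1]; exact Or.inl hyU), h1]
  obtain ⟨s₁, hs₁, y₁, hy₁, hfy₁⟩ := hstart x₁ W₁ hx₁ hW₁ hx₁W
  obtain ⟨s₂, hs₂, y₂, hy₂, hfy₂⟩ := hstart x₂ W₂ hx₂ hW₂ hx₂W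
  obtain ⟨Ψ₁, hΨ₁, hΨs₁, hfΨ₁, j₁, hj₁⟩ := hlift s₁ y₁ hfy₁
  obtain ⟨Ψ₂, hΨ₂, hΨs₂, hfΨ₂, j₂, hj₂⟩ := hlift s₂ y₂ hfy₂
  -- A connected half-plane cannot be split between `W₁` and `W₂`. Vertical translations preserve
  -- it, so the two lifts cannot be translates of each other.
  have hin₁ : {s : ℂ | s.re < M} ⊆ Ψ₁ ⁻¹' W₁ := by
    refine hhalf.subset_left_of_subset_union (hW₁.preimage hΨ₁) (hW₂.preimage hΨ₁)
      (hW.preimage _) (fun s hs => hDW _ ?_) ⟨s₁, hs₁, ?_⟩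
    · rw [hfΨ₁]; exact hΦM s hs
    · rw [Set.mem_preimage, hΨs₁]; exact hy₁
  have hin₂ : {s : ℂ | s.re < M} ⊆ Ψ₂ ⁻¹' W₂ := by
    refine hhalf.subset_right_of_subset_union (hW₁.preimage hΨ₂) (hW₂.preimage hΨ₂)
      (hW.preimage _) (fun s hs => hDW _ ?_) ⟨s₂, hs₂, ?_⟩
    · rw [hfΨ₂]; exact hΦM s hs
    · rw [Set.mem_preimage, hΨs₂]; exact hy₂
  have heq : ∀ s, Ψ₁ (s + 2 * Real.pi * j₁ * I) = Ψ₂ (s + 2 * Real.pi * j₂ * I) := by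
    refine eq_of_comp_eq (f := f) (y₀ := L (θ 0)) (by fun_prop) (by fun_prop) ?_ ?_ ?_
    · intro s; rw [hfΨ₁, hfΨ₂, hΦper, hΦper]
    · intro s; rw [hfΨ₁]; exact hΦP _
    · rw [hj₁, hj₂]
  have hre : ∀ j : ℤ, (((M - 1 : ℝ) : ℂ) + 2 * Real.pi * j * I).re < M := by
    intro j
    simp
  have h1 := hin₁ (hre j₁)
  have h2 := hin₂ (hre j₂)
  rw [Set.mem_preimage, ← heq] at h2
  exact Set.disjoint_left.1 hW h1 h2

/-! ### Fibres and the degree. -/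

theorem isPreconnected_compl_of_finite {P : Set Sphere2} (hP : P.Finite) : IsPreconnected Pᶜ := by
  have h1 : IsPreconnected (((↑) : ℂ → Sphere2) ⁻¹' P)ᶜ := by
    refine (Set.Countable.isConnected_compl_of_one_lt_rank ?_ ?_).isPreconnected
    · rw [rank_real_complex]; norm_num
    · exact (hP.preimage OnePoint.coe_injective.injOn).countable
  have h2 := h1.image ((↑) : ℂ → Sphere2) OnePoint.continuous_coe.continuousOn
  refine h2.subset_closure ?_ ?_
  · rintro _ ⟨z, hz, rfl⟩
    exact hz
  · intro z _
    have hd : Dense (Set.univ \ insert OnePoint.infty P : Set Sphere2) :=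
      dense_univ.sdiff_finite (hP.insert _)
    refine closure_mono ?_ (hd z)
    rintro w ⟨-, hw⟩
    rw [Set.mem_insert_iff, not_or] at hw
    obtain ⟨c, rfl⟩ := OnePoint.ne_infty_iff_exists.1 hw.1
    exact ⟨c, hw.2, rfl⟩

/-- If some nonempty open set consists of points with at most one preimage, then the degree is at
most one. -/
theorem IsThurstonMap.not_forall_subsingleton {f : Sphere2 → Sphere2} (hf : IsThurstonMap f)
    {U : Set Sphere2} (hU : IsOpen U) (hne : U.Nonempty)
    (h : ∀ y ∈ U, (f ⁻¹' {y}).Subsingleton) : False := by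
  have hb := hf.isBranchedCovering
  set A : Set Sphere2 := {y | (f ⁻¹' {y}).Subsingleton ∧ y ∉ postcriticalSet f}
  set B : Set Sphere2 := {y | ¬ (f ⁻¹' {y}).Subsingleton}
  have hPc := hf.finite_postcriticalSet.isClosed
  have hB : IsOpen B := by
    rw [isOpen_iff_mem_nhds]
    intro y hy
    obtain ⟨x₁, hx₁, x₂, hx₂, hne⟩ := Set.not_subsingleton_iff.1 hy
    obtain ⟨W₁, W₂, hW₁, hW₂, hx₁W, hx₂W, hd⟩ := t2_separation hne
    have h1 := hb.isOpenMap.image_mem_nhds (hW₁.mem_nhds hx₁W)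
    have h2 := hb.isOpenMap.image_mem_nhds (hW₂.mem_nhds hx₂W)
    rw [show f x₁ = y from hx₁] at h1
    rw [show f x₂ = y from hx₂] at h2
    filter_upwards [h1, h2]
    rintro z ⟨a, ha, haz⟩ ⟨b, hb, hbz⟩ hs
    have : a = b := hs haz hbz
    exact Set.disjoint_left.1 hd ha (this ▸ hb)
  have hA : IsOpen A := by
    rw [isOpen_iff_mem_nhds]
    rintro y ⟨hy, hyP⟩
    obtain ⟨x, hx⟩ := hb.surjective y
    obtain ⟨N, hN, hinj⟩ := exists_injOn_of_notMem (f := f) (x := x) (by rwa [hx])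
    obtain ⟨O, hON, hO, hxO⟩ := mem_nhds_iff.1 hN
    have hcl := (hb.1.isClosedMap _ hO.isClosed_compl).isOpen_compl
    have hyO : y ∈ (f '' Oᶜ)ᶜ := by
      rintro ⟨z, hz, hzy⟩
      exact hz (hy hx hzy ▸ hxO)
    filter_upwards [hcl.mem_nhds hyO, hPc.isOpen_compl.mem_nhds hyP] with w hw hwP
    refine ⟨fun a ha b hb => ?_, hwP⟩
    have hmem : ∀ a, f a = w → a ∈ N := fun a ha => by
      by_contra hc
      exact hw ⟨a, fun h => hc (hON h), ha⟩
    exact hinj (hmem a ha) (hmem b hb) (ha.trans hb.symm)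
  have hdense : Dense (postcriticalSet f)ᶜ := by
    rw [Set.compl_eq_univ_sdiff]
    exact dense_univ.sdiff_finite hf.finite_postcriticalSet
  have hcon := isPreconnected_compl_of_finite hf.finite_postcriticalSet
  obtain ⟨u, huU, huP⟩ := hdense.inter_open_nonempty U hU hne
  have hBne : B.Nonempty := by
    by_contra hc
    have hall : ∀ y, (f ⁻¹' {y}).Subsingleton := fun y => by
      by_contra hy
      exact hc ⟨y, hy⟩
    have h2 := hf.two_le_degree
    have h1 : degree f ≤ 1 := iSup_le fun y => Set.encard_le_one_iff_subsingleton.2 (hall y)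
    exact absurd (h2.trans h1) (by norm_num)
  obtain ⟨b, hbB, hbP⟩ := hdense.inter_open_nonempty B hB hBne
  -- One preimage and several preimages are both open conditions off the finite postcritical set,
  -- whose complement is connected, so they cannot both occur.
  obtain ⟨z, -, hzA, hzB⟩ := hcon A B hA hB
    (fun y hy => by
      by_cases hs : (f ⁻¹' {y}).Subsingleton
      exacts [Or.inl ⟨hs, hy⟩, Or.inr hs])
    ⟨u, huP, h u huU, huP⟩ ⟨b, hbP, hbB⟩
  exact hzB hzA.1

/-! ### Oriented charts and the positive local degree. -/

theorem exists_mobius_stdParam {x y : Sphere2} (h : x ≠ y) :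
    ∃ α β : ℂ, α ≠ 0 ∧ ∀ w ≠ 0, mobius x y (stdParam x w) = w / (α + β * w) := by
  induction x using OnePoint.rec with
  | infty =>
    induction y using OnePoint.rec with
    | infty => exact absurd rfl h
    | coe b =>
      refine ⟨-1, b, by norm_num, fun w hw => ?_⟩
      have h1 : stdParam OnePoint.infty w = ((w⁻¹ : ℂ) : Sphere2) := if_neg hw
      rw [h1]
      simp only [mobius, bracket, num_coe, den_coe, num_infty, den_infty]
      rw [show w⁻¹ * 1 - 1 * b = -((-1 + b * w) / w) by field_simp; ring]
      rw [div_neg, div_div_eq_mul_div]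
      ring
  | coe a =>
    refine ⟨bracket a y, den y, bracket_ne_zero h, fun w hw => ?_⟩
    have h1 : stdParam (a : Sphere2) w = ((a + w : ℂ) : Sphere2) := rfl
    rw [h1]
    simp only [mobius, bracket, num_coe, den_coe]
    congr 1 <;> ring

/-- This links the orientation convention of `stdParam` to the Möbius coordinate: their ratio has a
logarithm near `0`, so small circles wind alike in both. -/
theorem exists_log_mobius_stdParam {x y : Sphere2} (h : x ≠ y) :
    ∃ r > 0, ∃ ℓ : ℂ → ℂ, ContinuousOn ℓ (Metric.ball 0 r) ∧
      ∀ w ∈ Metric.ball (0 : ℂ) r, w ≠ 0 → mobius x y (stdParam x w) = w * exp (ℓ w) := by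
  obtain ⟨α, β, hα, hm⟩ := exists_mobius_stdParam h
  have hcont : ContinuousAt (fun w : ℂ => 1 + β / α * w) 0 := by fun_prop
  have hslit : ∀ᶠ w in 𝓝 (0 : ℂ), 1 + β / α * w ∈ slitPlane :=
    hcont (isOpen_slitPlane.mem_nhds (by simp))
  obtain ⟨r, hr, hball⟩ := Metric.mem_nhds_iff.1 hslit
  refine ⟨r, hr, fun w => -(log α + log (1 + β / α * w)), ?_, fun w hw hw0 => ?_⟩
  · refine (continuousOn_const.add (ContinuousOn.clog (by fun_prop) fun w hw => hball hw)).neg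
  · have h1 : 1 + β / α * w ≠ 0 := slitPlane_ne_zero (hball hw)
    rw [hm w hw0, Complex.exp_neg, Complex.exp_add, exp_log hα, exp_log h1, div_eq_mul_inv]
    congr 2
    field_simp

theorem log_shift_int {S : Set ℂ} (hS : ∀ s ∈ S, ∀ m : ℤ, s + 2 * Real.pi * m * I ∈ S)
    {L : ℂ → ℂ} {k : ℤ} (hL : ∀ s ∈ S, L (s + 2 * Real.pi * I) = L s + 2 * Real.pi * k * I)
    (m : ℤ) {s : ℂ} (hs : s ∈ S) :
    L (s + 2 * Real.pi * m * I) = L s + 2 * Real.pi * (m * k : ℤ) * I := by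
  induction m using Int.induction_on with
  | zero => simp
  | succ i ih =>
    have h1 := hL _ (hS s hs i)
    rw [ih] at h1
    rw [show s + 2 * Real.pi * (i + 1 : ℤ) * I = s + 2 * Real.pi * (i : ℤ) * I + 2 * Real.pi * I by
      push_cast; ring, h1]
    push_cast; ring
  | pred i ih =>
    have h1 := hL _ (hS s hs (-i - 1))
    rw [show s + 2 * Real.pi * (-(i : ℤ) - 1 : ℤ) * I + 2 * Real.pi * I =
      s + 2 * Real.pi * (-(i : ℤ) : ℤ) * I by push_cast; ring, ih] at h1
    have h2 := eq_sub_of_add_eq h1.symm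
    rw [h2]
    push_cast; ring

theorem re_shift (s : ℂ) (m : ℤ) : (s + 2 * Real.pi * m * I).re = s.re := by simp

theorem shift_mem_halfPlane (M : ℝ) :
    ∀ s ∈ {s : ℂ | s.re < M}, ∀ m : ℤ, s + 2 * Real.pi * m * I ∈ {s : ℂ | s.re < M} :=
  fun s hs m => by rw [Set.mem_ofPred_eq, re_shift]; exact hs

theorem exists_int_of_log_shift {S : Set ℂ} (hS : IsPreconnected S)
    (hSs : ∀ s ∈ S, ∀ m : ℤ, s + 2 * Real.pi * m * I ∈ S) {h L : ℂ → ℂ}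
    (hL : ContinuousOn L S) (hexp : ∀ s ∈ S, h s = exp (L s))
    (hper : ∀ s ∈ S, h (s + 2 * Real.pi * I) = h s) :
    ∃ k : ℤ, ∀ s ∈ S, L (s + 2 * Real.pi * I) = L s + 2 * Real.pi * k * I := by
  have hmem : ∀ s ∈ S, s + 2 * Real.pi * I ∈ S := fun s hs => by simpa using hSs s hs 1
  refine exists_int_of_exp_eq hS (A := fun s => L (s + 2 * Real.pi * I)) ?_ hL fun s hs => ?_
  · exact hL.comp (by fun_prop) hmem
  · rw [← hexp s hs, ← hexp _ (hmem s hs), hper s hs]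

/-- In the exponential coordinate around `x`, an orientation-preserving chart centred at `x` has a
logarithm that grows by `2πi` over each period. -/
theorem IsOrientationPreserving.exists_log {φ : OpenPartialHomeomorph Sphere2 ℂ}
    (hφ : IsOrientationPreserving φ) {x y : Sphere2} (hx : x ∈ φ.source) (hφx : φ x = 0)
    (hxy : x ≠ y) :
    ∃ (M : ℝ) (L : ℂ → ℂ), ContinuousOn L {s | s.re < M} ∧
      (∀ s ∈ {s : ℂ | s.re < M}, expCover x y s ∈ φ.source ∧ φ (expCover x y s) = exp (L s)) ∧
      ∀ s ∈ {s : ℂ | s.re < M}, L (s + 2 * Real.pi * I) = L s + 2 * Real.pi * (1 : ℤ) * I := by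
  obtain ⟨M, hM⟩ := exists_expCover_mem hxy (φ.open_source.mem_nhds hx)
  have hcont : ContinuousOn (fun s => φ (expCover x y s)) {s | s.re < M} :=
    φ.continuousOn.comp (continuous_expCover hxy).continuousOn hM
  obtain ⟨L, hL, hexp⟩ := exists_log_of_convex (convex_halfSpace_re_lt M) hcont fun s hs h0 =>
    expCover_ne_left hxy s (φ.injOn (hM s hs) hx (h0.trans hφx.symm))
  have hper : ∀ s, expCover x y (s + 2 * Real.pi * I) = expCover x y s := fun s => by
    simpa using expCover_add_int (u := x) (v := y) s 1
  obtain ⟨k, hk⟩ := exists_int_of_log_shift (convex_halfSpace_re_lt M).isPreconnected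
    (shift_mem_halfPlane M) hL hexp (fun s _ => by rw [hper])
  suffices k = 1 by
    subst this
    exact ⟨M, L, hL, fun s hs => ⟨hM s hs, hexp s hs⟩, hk⟩
  obtain ⟨r₀, hr₀, ℓ, hℓ, hmob⟩ := exists_log_mobius_stdParam hxy
  have hsmall : ∀ᶠ w in 𝓝 (0 : ℂ), ‖w * exp (ℓ w)‖ < Real.exp M := by
    have h1 : ContinuousAt (fun w => ‖w * exp (ℓ w)‖) 0 :=
      (continuousAt_id.mul (hℓ.continuousAt (Metric.ball_mem_nhds _ hr₀)).cexp).norm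
    refine h1.eventually_lt continuousAt_const ?_
    simpa using Real.exp_pos M
  obtain ⟨r₁, hr₁, hball⟩ := Metric.mem_nhds_iff.1 hsmall
  have hev : ∀ᶠ r : ℝ in 𝓝[>] 0, 0 < r ∧ r < r₀ ∧ r < r₁ := by
    filter_upwards [self_mem_nhdsWithin, nhdsWithin_le_nhds (gt_mem_nhds hr₀),
      nhdsWithin_le_nhds (gt_mem_nhds hr₁)] with r h1 h2 h3 using ⟨h1, h2, h3⟩
  obtain ⟨r, hw, hr, hrr₀, hrr₁⟩ := ((hφ x hx).and hev).exists
  have hnorm : ∀ t : ℝ, ‖(r : ℂ) * exp (t * I)‖ = r := fun t => by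
    rw [norm_mul, norm_exp_ofReal_mul_I, mul_one, norm_real, Real.norm_of_nonneg hr.le]
  have hb : ∀ {ρ : ℝ}, r < ρ → ∀ t : ℝ, (r : ℂ) * exp (t * I) ∈ Metric.ball (0 : ℂ) ρ :=
    fun h t => by rw [mem_ball_zero_iff, hnorm]; exact h
  have hne : ∀ t : ℝ, (r : ℂ) * exp (t * I) ≠ 0 := fun t =>
    mul_ne_zero (by exact_mod_cast hr.ne') (exp_ne_zero _)
  -- A lift of the small standard circle around `x` to the exponential coordinate, translated by
  -- `2πi` per turn. Composing `L` with it compares `k` with the winding number `1` of the chart.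
  set σ : ℝ → ℂ := fun t => Real.log r + t * I + ℓ (r * exp (t * I)) with hσ
  have hσc : Continuous σ := by
    have : Continuous fun t : ℝ => ℓ (r * exp (t * I)) :=
      hℓ.comp_continuous (by fun_prop) (hb hrr₀)
    exact (continuous_const.add (by fun_prop)).add this
  have hσexp : ∀ t : ℝ, (r * exp (t * I)) * exp (ℓ (r * exp (t * I))) = exp (σ t) := fun t => by
    simp only [hσ, Complex.exp_add, ← ofReal_exp, Real.exp_log hr]
  have hσmob : ∀ t : ℝ, mobius x y (stdParam x (r * exp (t * I))) = exp (σ t) := fun t => by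
    rw [hmob _ (hb hrr₀ t) (hne t), hσexp]
  have hσM : ∀ t, σ t ∈ {s : ℂ | s.re < M} := fun t => by
    have : ‖(r * exp (t * I)) * exp (ℓ (r * exp (t * I)))‖ < Real.exp M := hball (hb hrr₁ t)
    rw [hσexp, norm_exp] at this
    exact Real.exp_lt_exp.1 this
  have hσper : ∀ t, σ (t + 2 * Real.pi) = σ t + 2 * Real.pi * I := fun t => by
    have : exp ((t + 2 * Real.pi : ℝ) * I) = exp (t * I) :=
      exp_eq_exp_iff_exists_int.2 ⟨1, by push_cast; ring⟩
    simp only [hσ, this]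
    push_cast; ring
  have hcirc : ∀ t : ℝ, expCover x y (σ t) = stdParam x (r * exp (t * I)) := fun t => by
    refine expCover_eq_of_mobius hxy (fun h => ?_) (hσmob t)
    have := hσmob t
    rw [h, ← mobius_inv, mobius_self, inv_zero] at this
    exact exp_ne_zero _ this.symm
  have hwk : HasWindingNumber (fun t => φ (stdParam x (r * exp (t * I))) - φ x) k := by
    refine ⟨fun t => L (σ t), hL.comp_continuous hσc hσM, fun t => ?_, fun t => ?_⟩
    · simp only [hφx, sub_zero, ← hcirc]
      exact hexp _ (hσM t)
    · simp only [hσper]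
      exact hk _ (hσM t)
  exact hwk.unique hw

/-- The local degree of a branched covering is positive. -/
theorem IsBranchedCovering.exists_local_log {f : Sphere2 → Sphere2} (hf : IsBranchedCovering f)
    {x y q : Sphere2} (hxy : x ≠ y) (hq : f x ≠ q) :
    ∃ (M : ℝ) (d : ℤ) (L : ℂ → ℂ), 0 < d ∧ ContinuousOn L {s | s.re < M} ∧
      (∀ s ∈ {s : ℂ | s.re < M}, mobius (f x) q (f (expCover x y s)) = exp (L s)) ∧
      ∀ s ∈ {s : ℂ | s.re < M}, L (s + 2 * Real.pi * I) = L s + 2 * Real.pi * d * I := by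
  obtain ⟨d, φ, ψ, hd, hφ, hψ, hx, hfx, hφx, hψx, hloc⟩ := hf.2 x
  obtain ⟨M₁, L₁, hL₁, hexp₁, hinc₁⟩ := hφ.exists_log hx hφx hxy
  obtain ⟨M₂, L₂, hL₂, hexp₂, hinc₂⟩ := hψ.exists_log hfx hψx hq
  have hN : ∀ᶠ z in 𝓝 x, f z ≠ q ∧ ‖mobius (f x) q (f z)‖ < Real.exp M₂ := by
    refine (hf.1.tendsto x).eventually (p := fun w => w ≠ q ∧ ‖mobius (f x) q w‖ < Real.exp M₂)
      (Filter.Eventually.and (isOpen_ne.mem_nhds hq) ?_)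
    refine (continuousAt_mobius (u := f x) hq).norm.eventually_lt continuousAt_const ?_
    rw [mobius_self, norm_zero]
    exact Real.exp_pos _
  obtain ⟨M₀, hM₀⟩ := exists_expCover_mem hxy hN
  set M := min M₀ M₁
  have hle₁ : ∀ s ∈ {s : ℂ | s.re < M}, s ∈ {s : ℂ | s.re < M₁} :=
    fun s hs => (show s.re < M from hs).trans_le (min_le_right _ _)
  have hle₀ : ∀ s ∈ {s : ℂ | s.re < M}, s.re < M₀ :=
    fun s hs => (show s.re < M from hs).trans_le (min_le_left _ _)
  set e := expCover x y
  have hec : Continuous e := continuous_expCover hxy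
  have hq' : ∀ s ∈ {s : ℂ | s.re < M}, f (e s) ≠ q := fun s hs => (hM₀ s (hle₀ s hs)).1
  have hψf : ∀ s ∈ {s : ℂ | s.re < M}, ψ (f (e s)) = exp (d * L₁ s) := fun s hs => by
    obtain ⟨h1, h2⟩ := hexp₁ s (hle₁ s hs)
    rw [(hloc _ h1).2, h2, ← exp_nat_mul]
  have hp' : ∀ s ∈ {s : ℂ | s.re < M}, f (e s) ≠ f x := fun s hs h => by
    have := hψf s hs
    rw [h, hψx] at this
    exact exp_ne_zero _ this.symm
  obtain ⟨L, hL, hexp⟩ := exists_log_of_convex (convex_halfSpace_re_lt M)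
    (h := fun s => mobius (f x) q (f (e s)))
    (fun s hs => ((continuousAt_mobius (hq' s hs)).comp (f := fun s => f (e s))
      (hf.1.comp hec).continuousAt).continuousWithinAt)
    (fun s hs => mobius_ne_zero (hp' s hs) (hq' s hs))
  have hper : ∀ s, e (s + 2 * Real.pi * I) = e s := fun s => by
    simpa using expCover_add_int (u := x) (v := y) s 1
  obtain ⟨k, hk⟩ := exists_int_of_log_shift (convex_halfSpace_re_lt M).isPreconnected
    (shift_mem_halfPlane M) hL hexp (fun s _ => by rw [hper])
  have hLM : ∀ s ∈ {s : ℂ | s.re < M}, L s ∈ {s : ℂ | s.re < M₂} := fun s hs => by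
    have := (hM₀ s (hle₀ s hs)).2
    change ‖mobius (f x) q (f (e s))‖ < _ at this
    rw [show mobius (f x) q (f (e s)) = exp (L s) from hexp s hs, norm_exp] at this
    exact Real.exp_lt_exp.1 this
  have hfe : ∀ s ∈ {s : ℂ | s.re < M}, expCover (f x) q (L s) = f (e s) := fun s hs =>
    expCover_eq_of_mobius hq (hq' s hs) (hexp s hs)
  -- Both sides are logarithms of `ψ (f (e s))`; comparing their increments under `s ↦ s + 2πi`
  -- gives `k = d`.
  obtain ⟨n, hn⟩ := exists_int_of_exp_eq (convex_halfSpace_re_lt M).isPreconnected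
    (A := fun s => L₂ (L s)) (B := fun s => d * L₁ s) (hL₂.comp hL hLM)
    (continuousOn_const.mul (hL₁.mono hle₁)) (fun s hs => by
      rw [← hψf s hs, ← (hexp₂ _ (hLM s hs)).2, hfe s hs])
  have hkd : k = d := by
    set s : ℂ := ((M - 1 : ℝ) : ℂ)
    have hs : s ∈ {s : ℂ | s.re < M} := by simp [s]
    have hs' : s + 2 * Real.pi * I ∈ {s : ℂ | s.re < M} := by
      simpa using shift_mem_halfPlane M s hs 1
    have h1 := hn s hs
    have h2 := hn _ hs'
    rw [hk s hs, log_shift_int (shift_mem_halfPlane M₂) hinc₂ k (hLM s hs),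
      hinc₁ s (hle₁ s hs), h1] at h2
    apply two_pi_mul_I_injective
    push_cast at h2 ⊢
    linear_combination h2
  exact ⟨M, d, L, by exact_mod_cast hd, hL, hexp, hkd ▸ hk⟩

/-! ### Sides of the preimage curve and orientation. -/

/-- A map that sends the complement of `δ` to the complement of `γ` maps sides into sides. -/
theorem AreSides.mapsTo_of_mem {f : Sphere2 → Sphere2} (hf : Continuous f)
    {γ δ : Circle → Sphere2} (hδr : Set.range δ = f ⁻¹' Set.range γ) {U V U' V' : Set Sphere2}
    (h : AreSides γ U V) (h' : AreSides δ U' V') {x : Sphere2} (hx : x ∈ U') (hfx : f x ∈ U) :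
    Set.MapsTo f U' U := by
  refine h'.isPreconnected_left.subset_left_of_subset_union (h.isOpen_left.preimage hf)
    (h.isOpen_right.preimage hf) (h.disjoint.preimage f) (fun z hz => ?_) ⟨x, hx, hfx⟩
  refine h.mem_or_mem fun hz' => h'.left_notMem hz ?_
  rw [hδr]
  exact hz'

/-- If the covering `δ → γ` preserves orientation, then the unique preimage of `p` lies on the
same side of `δ` as `p` itself. -/
theorem IsBranchedCovering.mem_side {f : Sphere2 → Sphere2} (hf : IsBranchedCovering f)
    {γ δ : Circle → Sphere2} (hγ : Continuous γ) (hγi : Function.Injective γ) (hδ : Continuous δ)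
    (hδi : Function.Injective δ) (hδr : Set.range δ = f ⁻¹' Set.range γ) {θ : ℝ → ℝ}
    (hθ : Continuous θ) (hθm : StrictMono θ)
    (hfδ : ∀ t, f (δ (Circle.exp t)) = γ (Circle.exp (θ t))) {U V U' V' : Set Sphere2}
    (h : AreSides γ U V) (h' : AreSides δ U' V') {p q x : Sphere2} (hp : p ∈ U) (hq : q ∈ V)
    (hp' : p ∈ U') (hq' : q ∈ V') (hidx : index δ p q = index γ p q) (hx : f x = p)
    (hfib : (f ⁻¹' {p}).Subsingleton) : x ∈ U' := by
  have hpE := h.left_notMem hp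
  have hqE := h.right_notMem hq
  have hxδ : x ∉ Set.range δ := by
    rw [hδr, Set.mem_preimage, hx]
    exact hpE
  refine (h'.mem_or_mem hxδ).resolve_right fun hxV => ?_
  have h'' := h'.symm hδ
  have hmaps := AreSides.mapsTo_of_mem hf.1 hδr h h'' hxV (hx ▸ hp)
  have hpq := h.ne hp hq
  have hxp : x ≠ p := h''.ne hxV hp'
  obtain ⟨Φ, hΦ, hΦmem, hΦx, hΦper, hΦe⟩ := h''.exists_retracted_expCover hδ hδi hxV hp'
  have hfΦ : ∀ s, f (Φ s) ∈ U ∪ Set.range γ := fun s => (hΦmem s).elim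
    (fun hs => Or.inl (hmaps hs)) (fun hs => Or.inr (by rw [hδr] at hs; exact hs))
  have hfΦq : ∀ s, f (Φ s) ≠ q := fun s he => (hfΦ s).elim
    (fun hs => h.ne hs hq he) (fun hs => hqE (he ▸ hs))
  have hfΦp : ∀ s, f (Φ s) ≠ p := fun s he => hΦx s (hfib he hx)
  -- `f ∘ Φ` avoids `q` by its range, and avoids `p` because `Φ` misses `x`, the only preimage of
  -- `p`. The increment of `L` is computed twice: near `x`, and along `δ`.
  obtain ⟨L, hL, hLexp⟩ := ThurstonMap.exists_log (h := fun s => mobius p q (f (Φ s)))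
    (continuous_iff_continuousAt.2 fun s =>
      (continuousAt_mobius (hfΦq s)).comp (f := fun s => f (Φ s)) (hf.1.comp hΦ).continuousAt)
    (fun s => mobius_ne_zero (hfΦp s) (hfΦq s))
  obtain ⟨k, hk⟩ := exists_int_of_log_shift isPreconnected_univ (fun s _ _ => trivial)
    hL.continuousOn (fun s _ => hLexp s) (fun s _ => by
      have := hΦper s 1
      rw [Int.cast_one, mul_one] at this
      rw [this])
  obtain ⟨M₀, d, μ, hd, hμ, hμexp, hμinc⟩ := hf.exists_local_log hxp (hx ▸ hpq : f x ≠ q)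
  obtain ⟨M₁, hM₁⟩ := exists_expCover_mem hxp (h'.isOpen_right.mem_nhds hxV)
  set M := min M₀ M₁
  have hle₀ : ∀ s ∈ {s : ℂ | s.re < M}, s ∈ {s : ℂ | s.re < M₀} :=
    fun s hs => (show s.re < M from hs).trans_le (min_le_left _ _)
  have hle₁ : ∀ s ∈ {s : ℂ | s.re < M}, s.re < M₁ :=
    fun s hs => (show s.re < M from hs).trans_le (min_le_right _ _)
  obtain ⟨n, hn⟩ := exists_int_of_exp_eq (convex_halfSpace_re_lt M).isPreconnected
    (A := L) (B := μ) hL.continuousOn (hμ.mono hle₀) (fun s hs => by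
      rw [← hLexp, ← hμexp s (hle₀ s hs), hx, hΦe s (Or.inl (hM₁ s (hle₁ s hs)))])
  have hkd : k = d := by
    set s : ℂ := ((M - 1 : ℝ) : ℂ)
    have hs : s ∈ {s : ℂ | s.re < M} := by simp [s]
    have hs' : s + 2 * Real.pi * I ∈ {s : ℂ | s.re < M} := by
      simpa using shift_mem_halfPlane M s hs 1
    have h1 := hn s hs
    have h2 := hn _ hs'
    rw [hk s trivial, hμinc s (hle₀ s hs), h1] at h2
    apply two_pi_mul_I_injective
    linear_combination h2
  obtain ⟨A, hA, hAexp, hAinc⟩ := hasWindingNumber_index hδ hxδ (h'.left_notMem hp')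
  obtain ⟨B, hB, hBexp, hBinc⟩ := hasWindingNumber_index hγ hpE hqE
  have hΦA : ∀ t, Φ (A t) = δ (Circle.exp t) := fun t => by
    have h1 : expCover x p (A t) = δ (Circle.exp t) :=
      expCover_eq_of_mobius hxp (ne_of_notMem_range (h'.left_notMem hp') _) (hAexp t)
    rw [hΦe _ (by rw [h1]; exact Or.inr ⟨_, rfl⟩), h1]
  obtain ⟨j, hj⟩ := exists_int_of_exp_eq' (A := fun t => L (A t)) (B := fun t => B (θ t))
    (by fun_prop) (by fun_prop) (fun t => by rw [← hLexp, hΦA, hfδ, ← hBexp])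
  -- `m` is the degree of the covering of curves; monotonicity of `θ` makes it positive.
  obtain ⟨m, hm⟩ : ∃ m : ℤ, θ (2 * Real.pi) = θ 0 + m * (2 * Real.pi) := by
    apply Circle.exp_eq_exp.1
    apply hγi
    rw [← hfδ, ← hfδ, Circle.exp_two_pi, Circle.exp_zero]
  have hm0 : 0 < m := by
    have h1 := hθm Real.two_pi_pos
    rw [hm] at h1
    have h2 : 0 < (m : ℝ) * (2 * Real.pi) := by linarith
    have h3 : 0 < (m : ℝ) := pos_of_mul_pos_left h2 Real.two_pi_pos.le
    exact_mod_cast h3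
  have hA0 := hAinc 0
  rw [zero_add] at hA0
  have h1 := hj 0
  have h2 := hj (2 * Real.pi)
  rw [hm, hA0, log_shift_int (S := Set.univ) (fun s _ _ => trivial) hk _ (Set.mem_univ _),
    log_add_int_mul hBinc, h1] at h2
  have h3 : index δ x p * k = m * index γ p q := by
    apply two_pi_mul_I_injective
    linear_combination h2
  -- Since `x` and `q` lie on the same side of `δ`, `x` may be replaced by `q`, and exchanging `q`
  -- and `p` changes the sign. With `h3` this gives `m = -k`, impossible as both are positive.
  have h4 : index δ x p = -index γ p q := by
    have h5 := index_add hδ hxδ (h'.right_notMem hq') (h'.left_notMem hp')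
    rw [h'.index_right x hxV q hq', zero_add] at h5
    rw [← h5, index_neg hδ (h'.right_notMem hq') (h'.left_notMem hp'), hidx]
  rw [h4, hkd] at h3
  rcases h.index_eq p hp q hq with h5 | h5 <;> rw [h5] at h3 <;> omega

/-! ### Isotopy invariance and the conclusion. -/

theorem IsIsotopyRel.notMem_range {H : unitInterval → Sphere2 ≃ₜ Sphere2} {P : Set Sphere2}
    (hH : IsIsotopyRel H P) {γ : Circle → Sphere2} (hγP : Disjoint (Set.range γ) P) {p : Sphere2}
    (hp : p ∈ P) (τ : unitInterval) (z : Circle) : H τ (γ z) ≠ p := fun h => by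
  have : γ z = p := (H τ).injective (h.trans (hH.2.2 τ p hp).symm)
  exact Set.disjoint_left.1 hγP ⟨z, this⟩ hp

theorem IsIsotopyRel.index_eq {H : unitInterval → Sphere2 ≃ₜ Sphere2} {P : Set Sphere2}
    (hH : IsIsotopyRel H P) {γ : Circle → Sphere2} (hγ : Continuous γ)
    (hγP : Disjoint (Set.range γ) P) {p q : Sphere2} (hp : p ∈ P) (hq : q ∈ P) :
    index (fun z => H 1 (γ z)) p q = index γ p q := by
  apply ThurstonMap.index_eq
  refine HasWindingNumber.homotopy (F := fun τ t => mobius p q (H τ (γ (Circle.exp t)))) ?_ ?_ ?_ ?_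
  · refine continuous_iff_continuousAt.2 fun x => ?_
    exact (continuousAt_mobius (hH.notMem_range hγP hq x.1 _)).comp
      (f := fun x : unitInterval × ℝ => H x.1 (γ (Circle.exp x.2)))
      (hH.1.comp (f := fun x : unitInterval × ℝ => (x.1, γ (Circle.exp x.2)))
        (by fun_prop)).continuousAt
  · exact fun τ t => mobius_ne_zero (hH.notMem_range hγP hp τ _) (hH.notMem_range hγP hq τ _)
  · intro τ t
    simp [Circle.exp_add]
  · simp only [hH.2.1]
    exact hasWindingNumber_index hγ (fun h => Set.disjoint_left.1 hγP h hp)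
      (fun h => Set.disjoint_left.1 hγP h hq)

/-- If one side of an equator contains at most one postcritical point, then the map is a Thurston
polynomial. -/
theorem IsThurstonMap.isThurstonPolynomial {f : Sphere2 → Sphere2} (hf : IsThurstonMap f)
    {γ : Circle → Sphere2} (hγ : Continuous γ) (hi : Function.Injective γ)
    (hγP : Disjoint (Set.range γ) (postcriticalSet f)) {H : unitInterval → Sphere2 ≃ₜ Sphere2}
    (hH : IsIsotopyRel H (postcriticalSet f)) (hHE : H 1 '' Set.range γ = f ⁻¹' Set.range γ)
    (ho : PreservesCurveOrientation γ fun x => f (H 1 x)) {U V : Set Sphere2}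
    (h : AreSides γ U V) (hs : (postcriticalSet f ∩ U).Subsingleton) :
    IsThurstonPolynomial f := by
  have hb := hf.isBranchedCovering
  obtain ⟨θ, hθ, hθm, hfθ⟩ := ho
  set δ : Circle → Sphere2 := fun z => H 1 (γ z) with hδdef
  have hδ : Continuous δ := (H 1).continuous.comp hγ
  have hδi : Function.Injective δ := (H 1).injective.comp hi
  have hδr : Set.range δ = f ⁻¹' Set.range γ := by
    rw [← hHE, ← Set.range_comp]
    rfl
  have hfib : ∀ {U V : Set Sphere2}, AreSides γ U V → ∀ p ∈ U,
      (∀ z ∈ U, z ∈ postcriticalSet f → z = p) → (f ⁻¹' {p}).Subsingleton := by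
    intro U V h p hp hU
    obtain ⟨q, hq⟩ := h.nonempty_right
    exact hb.subsingleton_fiber hγ hi hδ hδr hθ hfθ hγP h hp hq hU
  -- On a side without postcritical points, every point can play the role of `p`, so all its fibres
  -- are singletons.
  have hmeets : ∀ {U V : Set Sphere2}, AreSides γ U V → (postcriticalSet f ∩ U).Nonempty := by
    intro U V h
    by_contra hc
    refine hf.not_forall_subsingleton h.isOpen_left h.nonempty_left fun y hy => ?_
    exact hfib h y hy fun z hz hzP => absurd ⟨z, hzP, hz⟩ hc
  obtain ⟨p, hpP, hp⟩ := hmeets h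
  obtain ⟨q, hqP, hq⟩ := hmeets (h.symm hγ)
  have hfibp := hfib h p hp fun z hz hzP => hs ⟨hzP, hz⟩ ⟨hpP, hp⟩
  obtain ⟨x, hx⟩ := hb.surjective p
  have hpδ : p ∉ Set.range δ := fun ⟨z, hz⟩ => hH.notMem_range hγP hpP 1 z hz
  have hqδ : q ∉ Set.range δ := fun ⟨z, hz⟩ => hH.notMem_range hγP hqP 1 z hz
  have hidx : index δ p q = index γ p q := hH.index_eq hγ hγP hpP hqP
  have hidx0 : index δ p q ≠ 0 := by
    rw [hidx]
    rcases h.index_eq p hp q hq with h' | h' <;> rw [h'] <;> norm_num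
  -- The nonzero index, inherited from `γ`, puts `p` and `q` on different sides of `δ`.
  obtain ⟨U', V', h', hp', hq'⟩ : ∃ U' V', AreSides δ U' V' ∧ p ∈ U' ∧ q ∈ V' := by
    obtain ⟨U', V', h'⟩ := exists_areSides hδ hδi
    rcases h'.mem_or_mem hpδ with hp' | hp' <;> rcases h'.mem_or_mem hqδ with hq' | hq'
    · exact absurd (h'.index_left p hp' q hq') hidx0
    · exact ⟨U', V', h', hp', hq'⟩
    · exact ⟨V', U', h'.symm hδ, hp', hq'⟩
    · exact absurd (h'.index_right p hp' q hq') hidx0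
  have hxU := hb.mem_side hγ hi hδ hδi hδr hθ hθm hfθ h h' hp hq hp' hq' hidx hx hfibp
  have hmaps := AreSides.mapsTo_of_mem hb.1 hδr h h' hxU (hx ▸ hp)
  -- `p` shares its side of `δ` with its preimage `x`, so `f p` lies in `U`; it is also
  -- postcritical, and `U` contains only one such point.
  have hfp : f p = p := hs ⟨map_mem_postcriticalSet hpP, hmaps hp'⟩ ⟨hpP, hp⟩
  exact ⟨hf, p, hfp, Set.eq_singleton_iff_unique_mem.2 ⟨hfp, fun z hz => hfibp hz hfp⟩⟩

end ThurstonMap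

theorem mainTheorem6 (f : ThurstonMap.Sphere2 → ThurstonMap.Sphere2)
    (hf : ThurstonMap.IsThurstonMap f) (hpoly : ¬ ThurstonMap.IsThurstonPolynomial f)
    (hpost : (ThurstonMap.postcriticalSet f).ncard ≤ 3) :
    ¬ ThurstonMap.HasEquator f := by
  rintro ⟨_, γ, hγ, hi, rfl, hγP, -, H, hH, hHE, ho⟩
  obtain ⟨U, V, h⟩ := ThurstonMap.exists_areSides hγ hi
  set P := ThurstonMap.postcriticalSet f with hP
  have hfin : P.Finite := hf.finite_postcriticalSet
  by_cases hU : (P ∩ U).Subsingleton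
  · exact hpoly (hf.isThurstonPolynomial hγ hi hγP hH hHE ho h hU)
  by_cases hV : (P ∩ V).Subsingleton
  · exact hpoly (hf.isThurstonPolynomial hγ hi hγP hH hHE ho (h.symm hγ) hV)
  -- Two postcritical points on each side would make four in all.
  have hfinU : (P ∩ U).Finite := hfin.subset Set.inter_subset_left
  have hfinV : (P ∩ V).Finite := hfin.subset Set.inter_subset_left
  have h1 := (Set.one_lt_ncard_iff_nontrivial_and_finite.2
    ⟨Set.not_subsingleton_iff.1 hU, hfinU⟩)
  have h2 := (Set.one_lt_ncard_iff_nontrivial_and_finite.2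
    ⟨Set.not_subsingleton_iff.1 hV, hfinV⟩)
  have h3 := Set.ncard_union_eq
    (h.disjoint.mono (Set.inter_subset_right : P ∩ U ⊆ U) Set.inter_subset_right) hfinU hfinV
  have h4 := Set.ncard_le_ncard
    (Set.union_subset Set.inter_subset_left Set.inter_subset_left : P ∩ U ∪ P ∩ V ⊆ P) hfin
  omega
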